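/- Let $(\Omega,\mathcal F)$ be a measurable space, $\Delta(\mathcal F)$ the set of probability measures on it, and $\emptyset\neq\mathfrak P\subset\Delta(\mathcal F)$. An event $N\in\mathcal F$ is $\mathfrak P$-polar if $\sup_{\mathbb P\in\mathfrak P}\mathbb P(N)=0$, and a property holds $\mathfrak P$-quasi surely (q.s.) if it holds outside a $\mathfrak P$-polar event. Let $L^\infty_{\mathbf c}$ be the space of equivalence classes, up to $\mathfrak P$-q.s. equality, of $\mathfrak P$-q.s. bounded measurable functions $\Omega\to\mathbb R$, with the $\mathfrak P$-q.s. order $\preceq$ and the norm $\|X\|=\inf\{m>0 : |X|\preceq m\mathbf 1_\Omega\}$, where $\mathbf 1_\Omega$ is the class of the constant function $1$. Let $ca_{\mathbf c}$ be the space of finite countably additive signed measures $\mu$ on $\mathcal F$ whose total variation measure $|\mu|$ vanishes on all $\mathfrak P$-polar events, with the norm $TV(\mu)=|\mu|(\Omega)$. We write $ca_{\mathbf c}^*=L^\infty_{\mathbf c}$ if $X\mapsto\big(\mu\mapsto\int X\,d\mu\big)$ is an isometric isomorphism of $L^\infty_{\mathbf c}$ onto the norm dual of $(ca_{\mathbf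 c},TV)$. A convex monetary risk measure on $L^\infty_{\mathbf c}$ is a convex function $\rho\colon L^\infty_{\mathbf c}\to\mathbb R$ such that $X\preceq Y$ implies $\rho(X)\le\rho(Y)$, and $\rho(X+m\mathbf 1_\Omega)=\rho(X)+m$ for all $X\in L^\infty_{\mathbf c}$ and $m\in\mathbb R$. A net $(X_i)_{i\in I}$ in $L^\infty_{\mathbf c}$ converges in order to $X$ if there is a decreasing net $(Y_i)_{i\in I}$ in $L^\infty_{\mathbf c}$ with $\inf_{i\in I}Y_i=0$ and $|X_i-X|\preceq Y_i$ for all $i\in I$. Consider the following properties of $\rho$. (F1) There is a function $\alpha\colon ca_{\mathbf c}\cap\Delta(\mathcal F)\to\mathbb R\cup\{\infty\}$, bounded from below and not identically $\infty$, such that $$\rho(X)=\sup_{\mathbb Q\in ca_{\mathbf c}\cap\Delta(\mathcal F)}\big(\mathbb E_{\mathbb Q}[X]-\alpha(\mathbb Q)\big)\quad\text{for all }X\in L^\infty_{\mathbf c}.$$ (F2) (Fatou property) Whenever a net $(X_i)_{i\in I}$ in $L^\infty_{\mathbf c}$ converges in order to $X\in L^\infty_{\mathbf c}$, then $\rho(X)\le\liminf_{i\in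 I}\rho(X_i)$. Suppose that $L^\infty_{\mathbf c}$ is Dedekind complete, i.e. every nonempty subset that is bounded above has a least upper bound. Then the following are equivalent: (1) For all convex monetary risk measures $\rho$ on $L^\infty_{\mathbf c}$, (F1) and (F2) are equivalent. (2) $ca_{\mathbf c}^*=L^\infty_{\mathbf c}$. -/

import Mathlib

open MeasureTheory Filter Set
open scoped ENNReal

universe u

namespace QuasiSure

noncomputable section

variable {Ω : Type u} [MeasurableSpace Ω]

/-- The upper probability `c(A) = sup_{P ∈ 𝔓} P(A)` of a set `𝔓` of probability measures. -/
def upperProb (𝔓 : Set (ProbabilityMeasure Ω)) (A : Set Ω) : ℝ≥0∞ :=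
  ⨆ P ∈ 𝔓, (P : Measure Ω) A

/-- `μ ≪ 𝔓`: the measure `μ` does not charge any `𝔓`-polar event. -/
def DominatedBy (𝔓 : Set (ProbabilityMeasure Ω)) (μ : Measure Ω) : Prop :=
  ∀ N, MeasurableSet N → upperProb 𝔓 N = 0 → μ N = 0

/-- The (in general not σ-finite) measure `∑_{P ∈ 𝔓} P`. It serves only to encode the polar events:
its measurable null sets are exactly the `𝔓`-polar events. -/
def polarMeasure (𝔓 : Set (ProbabilityMeasure Ω)) : Measure Ω :=
  Measure.sum fun P : 𝔓 => ((P : ProbabilityMeasure Ω) : Measure Ω)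

theorem polarMeasure_eq_zero_iff (𝔓 : Set (ProbabilityMeasure Ω)) {N : Set Ω}
    (hN : MeasurableSet N) : polarMeasure 𝔓 N = 0 ↔ upperProb 𝔓 N = 0 := by
  simp [polarMeasure, upperProb, Measure.sum_apply_eq_zero' hN]

/-- `L^∞_c`: classes, up to `𝔓`-quasi-sure equality, of `𝔓`-quasi surely bounded real random
variables. As an almost everywhere statement for `polarMeasure 𝔓` is the same as a `𝔓`-quasi sure
one, the order of this space is the quasi-sure order and its norm is the quasi-sure supremum norm;
see `exists_toLinf_eq`, `toLinf_eq_iff`, `toLinf_le_iff` and `norm_toLinf` below. -/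
abbrev Linf (𝔓 : Set (ProbabilityMeasure Ω)) : Type u :=
  Lp ℝ ∞ (polarMeasure 𝔓)

/-- `𝔓`-quasi sure boundedness of a function. -/
def QSBounded (𝔓 : Set (ProbabilityMeasure Ω)) (f : Ω → ℝ) : Prop :=
  ∃ m : ℝ, 0 < m ∧ upperProb 𝔓 {ω | m < |f ω|} = 0

theorem ae_abs_le_iff (𝔓 : Set (ProbabilityMeasure Ω)) {f : Ω → ℝ} (hf : Measurable f) (m : ℝ) :
    (∀ᵐ ω ∂polarMeasure 𝔓, ‖f ω‖ ≤ m) ↔ upperProb 𝔓 {ω | m < |f ω|} = 0 := by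
  rw [← polarMeasure_eq_zero_iff 𝔓 (measurableSet_lt measurable_const hf.abs), ae_iff]
  simp only [not_le, Real.norm_eq_abs]

/-- The class `[f]` in `L^∞_c` of a quasi surely bounded random variable `f`. -/
def toLinf (𝔓 : Set (ProbabilityMeasure Ω)) (f : Ω → ℝ) (hf : Measurable f)
    (hb : QSBounded 𝔓 f) : Linf 𝔓 :=
  (memLp_top_of_bound hf.aestronglyMeasurable hb.choose
    ((ae_abs_le_iff 𝔓 hf _).2 hb.choose_spec.2)).toLp f

theorem exists_toLinf_eq (𝔓 : Set (ProbabilityMeasure Ω)) (X : Linf 𝔓) :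
    ∃ (f : Ω → ℝ) (hf : Measurable f) (hb : QSBounded 𝔓 f), toLinf 𝔓 f hf hb = X := by
  have hf : Measurable (X : Ω → ℝ) := (Lp.stronglyMeasurable X).measurable
  have hb : QSBounded 𝔓 X := by
    refine ⟨‖X‖ + 1, by positivity, (ae_abs_le_iff 𝔓 hf _).1 ?_⟩
    have hfin : eLpNormEssSup X (polarMeasure 𝔓) ≠ ∞ := by
      simpa using Lp.eLpNorm_ne_top X
    filter_upwards [ae_le_eLpNormEssSup (f := X) (μ := polarMeasure 𝔓)] with ω hω
    have h2 := ENNReal.toReal_mono hfin hω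
    rw [toReal_enorm] at h2
    have h3 : ‖X‖ = (eLpNormEssSup X (polarMeasure 𝔓)).toReal := by
      rw [Lp.norm_def, eLpNorm_exponent_top]
    linarith
  exact ⟨X, hf, hb, Lp.toLp_coeFn X _⟩

theorem toLinf_eq_iff (𝔓 : Set (ProbabilityMeasure Ω)) {f g : Ω → ℝ} (hf : Measurable f)
    (hg : Measurable g) (hfb : QSBounded 𝔓 f) (hgb : QSBounded 𝔓 g) :
    toLinf 𝔓 f hf hfb = toLinf 𝔓 g hg hgb ↔ upperProb 𝔓 {ω | f ω ≠ g ω} = 0 := by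
  have h : MeasurableSet {ω | f ω ≠ g ω} := (measurableSet_eq_fun hf hg).compl
  rw [toLinf, toLinf, MemLp.toLp_eq_toLp_iff, ← polarMeasure_eq_zero_iff 𝔓 h]
  exact ae_iff

theorem toLinf_le_iff (𝔓 : Set (ProbabilityMeasure Ω)) {f g : Ω → ℝ} (hf : Measurable f)
    (hg : Measurable g) (hfb : QSBounded 𝔓 f) (hgb : QSBounded 𝔓 g) :
    toLinf 𝔓 f hf hfb ≤ toLinf 𝔓 g hg hgb ↔ upperProb 𝔓 {ω | g ω < f ω} = 0 := by
  have h1 : (toLinf 𝔓 f hf hfb : Ω → ℝ) =ᵐ[polarMeasure 𝔓] f := MemLp.coeFn_toLp _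
  have h2 : (toLinf 𝔓 g hg hgb : Ω → ℝ) =ᵐ[polarMeasure 𝔓] g := MemLp.coeFn_toLp _
  rw [← polarMeasure_eq_zero_iff 𝔓 (measurableSet_lt hg hf), ← Lp.coeFn_le]
  have h3 : polarMeasure 𝔓 {ω | g ω < f ω} = 0 ↔ f ≤ᵐ[polarMeasure 𝔓] g := by
    rw [EventuallyLE, ae_iff]
    simp only [not_le]
  rw [h3]
  constructor
  · intro h
    exact h1.symm.trans_le (h.trans_eq h2)
  · intro h
    exact h1.trans_le (h.trans_eq h2.symm)

theorem norm_toLinf (𝔓 : Set (ProbabilityMeasure Ω)) {f : Ω → ℝ} (hf : Measurable f)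
    (hfb : QSBounded 𝔓 f) :
    ‖toLinf 𝔓 f hf hfb‖ = sInf {m : ℝ | 0 < m ∧ upperProb 𝔓 {ω | m < |f ω|} = 0} := by
  have h1 : (toLinf 𝔓 f hf hfb : Ω → ℝ) =ᵐ[polarMeasure 𝔓] f := MemLp.coeFn_toLp _
  have hn : ‖toLinf 𝔓 f hf hfb‖ = (eLpNormEssSup f (polarMeasure 𝔓)).toReal := by
    rw [Lp.norm_def, eLpNorm_exponent_top, eLpNormEssSup_congr_ae h1]
  have hfin : eLpNormEssSup f (polarMeasure 𝔓) ≠ ∞ := by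
    rw [← eLpNormEssSup_congr_ae h1]
    simpa using Lp.eLpNorm_ne_top (toLinf 𝔓 f hf hfb)
  have key : ∀ m : ℝ, ‖toLinf 𝔓 f hf hfb‖ ≤ m → ∀ᵐ ω ∂polarMeasure 𝔓, ‖f ω‖ ≤ m := by
    intro m hm
    filter_upwards [ae_le_eLpNormEssSup (f := f) (μ := polarMeasure 𝔓)] with ω hω
    have h2 := ENNReal.toReal_mono hfin hω
    rw [toReal_enorm] at h2
    linarith
  refine le_antisymm (le_csInf hfb ?_) (le_of_forall_pos_le_add fun ε hε => csInf_le ?_ ?_)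
  · rintro m ⟨hm, hmf⟩
    rw [hn]
    refine ENNReal.toReal_le_of_le_ofReal hm.le ?_
    exact eLpNormEssSup_le_of_ae_bound ((ae_abs_le_iff 𝔓 hf m).2 hmf)
  · exact ⟨0, fun m hm => hm.1.le⟩
  · exact ⟨by positivity, (ae_abs_le_iff 𝔓 hf _).1 (key _ (by linarith))⟩

/-- The class `m • 1_Ω` of the constant random variable `m`. -/
def constLinf (𝔓 : Set (ProbabilityMeasure Ω)) (m : ℝ) : Linf 𝔓 :=
  (memLp_top_const m).toLp fun _ => m

/-- A partially ordered set is Dedekind complete if every nonempty subset that is bounded above has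
a least upper bound. -/
def IsDedekindComplete (E : Type*) [PartialOrder E] : Prop :=
  ∀ C : Set E, C.Nonempty → BddAbove C → ∃ s, IsLUB C s

/-- The space `ca_c` of the (finite) countably additive signed measures `μ` with `|μ| ≪ 𝔓`. -/
def ca (𝔓 : Set (ProbabilityMeasure Ω)) : Submodule ℝ (SignedMeasure Ω) where
  carrier := {μ | DominatedBy 𝔓 μ.totalVariation}
  add_mem' := by
    intro μ ν hμ hν N hN hc
    have h := VectorMeasure.variation_add_le (μ := μ) (ν := ν) N
    rw [← SignedMeasure.totalVariation_eq_variation, ← SignedMeasure.totalVariation_eq_variation,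
      ← SignedMeasure.totalVariation_eq_variation, Measure.add_apply, hμ N hN hc, hν N hN hc] at h
    simpa using h
  zero_mem' := by
    intro N _ _
    simp [SignedMeasure.totalVariation_eq_variation]
  smul_mem' := by
    intro c μ hμ N hN hc
    have h := hμ N hN hc
    rw [SignedMeasure.totalVariation_eq_variation] at h ⊢
    rw [VectorMeasure.variation_smul]
    simp [h]

/-- The total variation norm `TV(μ) = |μ|(Ω)` on `ca_c`. -/
instance instNormCa (𝔓 : Set (ProbabilityMeasure Ω)) : Norm (ca 𝔓) where
  norm μ := (μ : SignedMeasure Ω).totalVariation.real univ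

theorem norm_ca_def (𝔓 : Set (ProbabilityMeasure Ω)) (μ : ca 𝔓) :
    ‖μ‖ = (μ : SignedMeasure Ω).totalVariation.real univ := rfl

theorem normedSpaceCore_ca (𝔓 : Set (ProbabilityMeasure Ω)) : NormedSpace.Core ℝ (ca 𝔓) where
  norm_nonneg _ := measureReal_nonneg
  norm_smul c μ := by
    rw [norm_ca_def, norm_ca_def, Submodule.coe_smul, SignedMeasure.totalVariation_eq_variation,
      VectorMeasure.variation_smul, SignedMeasure.totalVariation_eq_variation]
    simp [Measure.real]
  norm_triangle μ ν := by
    rw [norm_ca_def, norm_ca_def, norm_ca_def, Submodule.coe_add, ← measureReal_add_apply]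
    refine ENNReal.toReal_mono (measure_ne_top _ _) ?_
    rw [SignedMeasure.totalVariation_eq_variation, SignedMeasure.totalVariation_eq_variation,
      SignedMeasure.totalVariation_eq_variation]
    exact VectorMeasure.variation_add_le univ
  norm_eq_zero_iff μ := by
    rw [norm_ca_def, measureReal_eq_zero_iff, Measure.measure_univ_eq_zero,
      SignedMeasure.totalVariation_eq_variation, VectorMeasure.variation_eq_zero,
      Submodule.coe_eq_zero]

instance instNormedAddCommGroupCa (𝔓 : Set (ProbabilityMeasure Ω)) :
    NormedAddCommGroup (ca 𝔓) :=
  NormedAddCommGroup.ofCore (normedSpaceCore_ca 𝔓)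

instance instNormedSpaceCa (𝔓 : Set (ProbabilityMeasure Ω)) : NormedSpace ℝ (ca 𝔓) :=
  NormedSpace.ofCore (normedSpaceCore_ca 𝔓)

/-- The integral `∫ X dμ = ∫ X dμ⁺ - ∫ X dμ⁻` with respect to a signed measure. -/
def signedIntegral (μ : SignedMeasure Ω) (f : Ω → ℝ) : ℝ :=
  ∫ ω, f ω ∂μ.toJordanDecomposition.posPart - ∫ ω, f ω ∂μ.toJordanDecomposition.negPart

/-- `ca_c^* = L^∞_c`: the pairing `(X, μ) ↦ ∫ X dμ` identifies `L^∞_c` isometrically with the norm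
dual of `(ca_c, TV)`. -/
def DualOfCaIsLinf (𝔓 : Set (ProbabilityMeasure Ω)) : Prop :=
  ∃ e : Linf 𝔓 ≃ₗᵢ[ℝ] StrongDual ℝ (ca 𝔓),
    ∀ (X : Linf 𝔓) (μ : ca 𝔓), e X μ = signedIntegral (μ : SignedMeasure Ω) X

/-- Order convergence of a net `x` to `a` in a lattice-ordered group. -/
def OrderConverges {E : Type*} [Lattice E] [AddGroup E] {I : Type*} [Preorder I]
    (x : I → E) (a : E) : Prop :=
  ∃ y : I → E, Antitone y ∧ IsGLB (range y) 0 ∧ ∀ i, |x i - a| ≤ y i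

/-- Convex monetary risk measures on `L^∞_c` (convex, monotone, cash-additive). -/
structure IsConvexRiskMeasure (𝔓 : Set (ProbabilityMeasure Ω)) (ρ : Linf 𝔓 → ℝ) : Prop where
  convex : ConvexOn ℝ univ ρ
  monotone : Monotone ρ
  cash_additive : ∀ (X : Linf 𝔓) (m : ℝ), ρ (X + constLinf 𝔓 m) = ρ X + m

/-- The set `ca_c ∩ Δ(F)` of the probability measures `Q ≪ 𝔓`. -/
abbrev DominatedProb (𝔓 : Set (ProbabilityMeasure Ω)) : Type u :=
  {Q : ProbabilityMeasure Ω // DominatedBy 𝔓 (Q : Measure Ω)}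

/-- The robust representation of `ρ` over all probability measures `Q ≪ 𝔓`, with a penalty
`α : ca_c ∩ Δ(F) → ℝ ∪ {∞}` that is bounded from below and not identically `∞`. -/
def HasRobustRepresentation (𝔓 : Set (ProbabilityMeasure Ω)) (ρ : Linf 𝔓 → ℝ) : Prop :=
  ∃ α : DominatedProb 𝔓 → EReal,
    (∃ b : ℝ, ∀ Q, (b : EReal) ≤ α Q) ∧ (∃ Q, α Q ≠ ⊤) ∧
    ∀ X : Linf 𝔓, (ρ X : EReal) =
      ⨆ Q : DominatedProb 𝔓, ((∫ ω, X ω ∂(Q.1 : Measure Ω) : ℝ) : EReal) - α Q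

/-- The Fatou property of `ρ`: lower semicontinuity along order convergent nets. -/
def HasFatouProperty (𝔓 : Set (ProbabilityMeasure Ω)) (ρ : Linf 𝔓 → ℝ) : Prop :=
  ∀ (I : Type u) [Preorder I] [Nonempty I] [IsDirectedOrder I] (X : I → Linf 𝔓) (Y : Linf 𝔓),
    OrderConverges X Y → (ρ Y : EReal) ≤ liminf (fun i => (ρ (X i) : EReal)) atTop

end

end QuasiSure

/-! Integration always embeds `L^∞_c` isometrically into the dual of `ca_c` (`norm_pairing`), so
`ca_c^* = L^∞_c` is a question of surjectivity. The pivot of the proof is the condition that every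
probability measure `Q ≪ 𝔓` has an order continuous expectation.

From (1) to (2): the expectation under `Q` has an obvious robust representation, so it has the Fatou
property and is order continuous. Dedekind completeness then gives `Q` a support `S_Q`, on which
`Q`-null events are polar (`exists_support`). A functional on `ca_c` has a bounded density on the
measures dominated by a given `Q`. Densities for different `Q` agree quasi surely where supports
meet, and Dedekind completeness glues them into one element of `L^∞_c` (`exists_glue`,
`pairing_surjective`).

From (2) to (1): weak-* compactness gives order continuity of every `Q` (`orderContinuous_of_dual`),
so a supremum of penalised expectations has the Fatou property. Conversely, let `ρ` have the Fatou
property. Its level sets, viewed in the dual of `ca_c`, have weak-* closed bounded parts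
(`level_mem_of_weak_closure`). The separation form of Krein–Šmulian then yields an element of
`ca_c`. Its sign is fixed by monotonicity of `ρ`, and normalising gives an approximate subgradient
`Q` at any prescribed point. The conjugate of `ρ` is therefore a penalty that represents `ρ`. -/

section KreinSmulian

/-! ### Krein–Šmulian separation in a dual Banach space -/

variable {E : Type*} [NormedAddCommGroup E] [NormedSpace ℝ E]

/-- Krein–Šmulian, finite step: a finite set whose polar misses `C ∩ k B` can be enlarged by finitely
many vectors of norm at most `1 / k` so that its polar misses `C ∩ r B`. -/
theorem exists_finset_polar_disjoint {C : Set (StrongDual ℝ E)} {k r : ℝ} (hk : 0 < k)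
    (hC : IsClosed (WeakDual.toStrongDual ⁻¹' (C ∩ Metric.closedBall 0 r) : Set (WeakDual ℝ E)))
    (A : Finset E) (hA : ∀ φ ∈ C, ‖φ‖ ≤ k → ∃ x ∈ A, 1 < |φ x|) :
    ∃ B : Finset E, A ⊆ B ∧ (∀ x ∈ B, x ∉ A → ‖x‖ ≤ k⁻¹) ∧
      ∀ φ ∈ C, ‖φ‖ ≤ r → ∃ x ∈ B, 1 < |φ x| := by
  classical
  have hclosed : ∀ x : E, IsClosed {φ : WeakDual ℝ E | |φ x| ≤ 1} := fun x =>
    isClosed_le (WeakDual.eval_continuous x).abs continuous_const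
  let D : Set (WeakDual ℝ E) :=
    WeakDual.toStrongDual ⁻¹' (C ∩ Metric.closedBall 0 r) ∩ ⋂ x ∈ A, {φ | |φ x| ≤ 1}
  have hD : IsCompact D := by
    refine (WeakDual.isCompact_closedBall (𝕜 := ℝ) (E := E) 0 r).of_isClosed_subset
      (hC.inter (isClosed_biInter fun x _ => hclosed x)) ?_
    rintro φ ⟨⟨_, h⟩, _⟩
    exact h
  -- A functional bounded by `1` on the ball of radius `1 / k` has norm at most `k`, where `hA`
  -- forbids it to lie in both `C` and the polar of `A`. Compactness of `D` then leaves finitely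
  -- many vectors of that ball.
  have hempty : ¬ (D ∩ ⋂ x : Metric.closedBall (0 : E) k⁻¹, {φ | |φ (x : E)| ≤ 1}).Nonempty := by
    rintro ⟨φ, ⟨⟨hφC, _⟩, hφA⟩, hφ⟩
    simp only [mem_iInter, mem_ofPred_eq] at hφA hφ
    have hn : ‖WeakDual.toStrongDual φ‖ ≤ k := by
      refine ContinuousLinearMap.opNorm_le_bound _ hk.le fun x => ?_
      rcases eq_or_ne x 0 with rfl | hx
      · simp
      have hx' : 0 < ‖x‖ := norm_pos_iff.2 hx
      have h := hφ ⟨(k⁻¹ * ‖x‖⁻¹) • x, by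
        rw [mem_closedBall_zero_iff, norm_smul, Real.norm_of_nonneg (by positivity), mul_assoc,
          inv_mul_cancel₀ hx'.ne', mul_one]⟩
      rw [map_smul, smul_eq_mul, abs_mul, abs_of_pos (by positivity), ← mul_inv,
        inv_mul_le_iff₀ (by positivity), mul_one] at h
      exact h
    obtain ⟨x, hx, h⟩ := hA _ hφC hn
    exact absurd (hφA x hx) (not_le.2 h)
  have := mt (hD.inter_iInter_nonempty _ fun x : Metric.closedBall (0 : E) k⁻¹ => hclosed x) hempty
  push Not at this
  obtain ⟨s, hs⟩ := this
  refine ⟨A ∪ s.image Subtype.val, Finset.subset_union_left, ?_, ?_⟩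
  · intro x hx hxA
    simp only [Finset.mem_union, hxA, false_or, Finset.mem_image] at hx
    obtain ⟨y, _, rfl⟩ := hx
    exact mem_closedBall_zero_iff.1 y.2
  · intro φ hφ hr
    by_contra hcon
    push Not at hcon
    refine (eq_empty_iff_forall_notMem.1 hs) (StrongDual.toWeakDual φ) ⟨⟨⟨hφ, by simpa using hr⟩, ?_⟩, ?_⟩
    · simp only [mem_iInter, mem_ofPred_eq]
      exact fun x hx => hcon x (Finset.mem_union_left _ hx)
    · simp only [mem_iInter, mem_ofPred_eq]
      exact fun x hx => hcon x (Finset.mem_union_right _ (Finset.mem_image_of_mem _ hx))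

/-- A set `C` with weak-* closed bounded parts that misses the unit ball misses the polar of a
totally bounded set. -/
theorem exists_totallyBounded_polar_disjoint {C : Set (StrongDual ℝ E)}
    (hC : ∀ n : ℕ,
      IsClosed (WeakDual.toStrongDual ⁻¹' (C ∩ Metric.closedBall 0 n) : Set (WeakDual ℝ E)))
    (h1 : ∀ φ ∈ C, 1 < ‖φ‖) :
    ∃ S : Set E, TotallyBounded S ∧ ∀ φ ∈ C, ∃ x ∈ S, 1 < |φ x| := by
  classical
  -- The radius is `k + 1`, so that stage `0` holds for the empty set by `h1`, and vectors added at
  -- stage `k` have norm at most `1 / (k + 1)`.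
  let P : ℕ → Finset E → Prop := fun k A => ∀ φ ∈ C, ‖φ‖ ≤ k + 1 → ∃ x ∈ A, 1 < |φ x|
  have step : ∀ k A, P k A → ∃ B, A ⊆ B ∧ (∀ x ∈ B, x ∉ A → ‖x‖ ≤ (k + 1 : ℝ)⁻¹) ∧ P (k + 1) B := by
    intro k A hA
    refine exists_finset_polar_disjoint (by positivity) ?_ A hA
    have := hC (k + 2)
    push_cast at this ⊢
    rwa [show (k + 1 + 1 : ℝ) = k + 2 by ring]
  choose f hsub hsmall hP using step
  have h0 : P 0 ∅ := by
    intro φ hφ hn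
    have := h1 φ hφ
    norm_num at hn
    linarith
  let A : (k : ℕ) → {A // P k A} := fun k =>
    Nat.rec ⟨∅, h0⟩ (fun k B => ⟨f k B.1 B.2, hP k B.1 B.2⟩) k
  have hAsucc : ∀ k, (A (k + 1)).1 = f k (A k).1 (A k).2 := fun k => rfl
  have hlarge : ∀ k j, k ≤ j → ∀ x ∈ (A j).1, x ∉ (A k).1 → ‖x‖ ≤ (k + 1 : ℝ)⁻¹ := by
    intro k j hkj
    induction j, hkj using Nat.le_induction with
    | base => exact fun x hx hx' => absurd hx hx'
    | succ j hkj ih =>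
      intro x hx hxk
      by_cases hxj : x ∈ (A j).1
      · exact ih x hxj hxk
      · rw [hAsucc] at hx
        refine (hsmall j _ _ x hx hxj).trans ?_
        gcongr
  have hmono : Monotone fun k => (A k).1 := monotone_nat_of_le_succ fun k => by
    rw [hAsucc]; exact hsub _ _ _
  refine ⟨⋃ k, (A k).1, ?_, ?_⟩
  · rw [Metric.totallyBounded_iff]
    intro ε hε
    obtain ⟨k, hk⟩ := exists_nat_one_div_lt hε
    -- All vectors added after stage `k` lie in the `ε`-ball about `0`, so `0` and the finite set `A
    -- k` are enough centres.
    refine ⟨insert 0 (A k).1, ((A k).1.finite_toSet.insert 0), ?_⟩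
    intro x hx
    obtain ⟨j, hj⟩ := mem_iUnion.1 hx
    by_cases hxk : x ∈ (A k).1
    · exact mem_biUnion (mem_insert_of_mem _ hxk) (Metric.mem_ball_self hε)
    · refine mem_biUnion (mem_insert 0 _) ?_
      rw [mem_ball_zero_iff]
      have := hlarge k (max j k) (le_max_right _ _) x (hmono (le_max_left j k) hj) hxk
      rw [one_div] at hk
      exact this.trans_lt hk
  · intro φ hφ
    obtain ⟨k, hk⟩ := exists_nat_ge ‖φ‖
    obtain ⟨x, hx, h⟩ := (A k).2 φ hφ (by linarith)
    exact ⟨x, mem_iUnion.2 ⟨k, hx⟩, h⟩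

/-- Separation form of the Krein–Šmulian theorem: a convex subset of the dual of a Banach space which
misses the unit ball and whose bounded parts are weak-* closed is strictly separated from `0` by a
vector of the predual. -/
theorem exists_one_le_of_isClosed_inter_closedBall [CompleteSpace E] {C : Set (StrongDual ℝ E)}
    (hconv : Convex ℝ C)
    (hC : ∀ n : ℕ,
      IsClosed (WeakDual.toStrongDual ⁻¹' (C ∩ Metric.closedBall 0 n) : Set (WeakDual ℝ E)))
    (h1 : ∀ φ ∈ C, 1 < ‖φ‖) : ∃ x : E, ∀ φ ∈ C, 1 ≤ φ x := by
  classical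
  obtain ⟨S, hS, hSC⟩ := exists_totallyBounded_polar_disjoint hC h1
  let K : Set E := closedAbsConvexHull ℝ (insert 0 S)
  have hKc : IsCompact K :=
    isCompact_closedAbsConvexHull_of_totallyBounded (hS.insert 0)
  have hSK : insert 0 S ⊆ K := subset_closedAbsConvexHull
  have hKabs : AbsConvex ℝ K := absConvex_convexClosedHull
  have hKne : K.Nonempty := ⟨0, hSK (mem_insert 0 S)⟩
  have hcl : ∀ φ : C, IsClosed {x : E | 1 ≤ φ.1 x} := fun φ =>
    isClosed_le continuous_const φ.1.continuous
  -- Compactness reduces to finitely many `φ`. If these had no common point in `K`, Sion's minimax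
  -- theorem would give one `φ ∈ C` with `φ < 1` on all of `K`. As `K` is symmetric, `|φ| ≤ 1` on
  -- `S`, against the choice of `S`.
  have key : (K ∩ ⋂ φ : C, {x : E | 1 ≤ φ.1 x}).Nonempty := by
    refine hKc.inter_iInter_nonempty _ hcl fun s => ?_
    by_contra hcon
    rw [not_nonempty_iff_eq_empty, eq_empty_iff_forall_notMem] at hcon
    obtain ⟨φ, hφ, h⟩ := Sion.exists_lt_iInf_of_lt_iInf_of_finite (X := K) (Y := C)
      (f := fun x φ => -(φ x)) (t := (-1 : ℝ)) hKne hKc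
      (fun φ _ => φ.continuous.neg.lowerSemicontinuous.lowerSemicontinuousOn _)
      (fun φ _ => ((-φ).toLinearMap.convexOn hKabs.2).quasiconvexOn)
      hconv
      (fun x _ => (Continuous.upperSemicontinuous (by fun_prop)).upperSemicontinuousOn _)
      (fun x _ => ConcaveOn.quasiconcaveOn ⟨hconv, fun φ _ ψ _ a b _ _ _ => by
        simp [add_comm]⟩)
      hKabs.2 (s := (s.image Subtype.val : Finset (StrongDual ℝ E)))
      (Finset.finite_toSet _) (by intro φ hφ; simp at hφ; exact hφ.1)
      (by
        intro x hx
        by_contra hx'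
        push Not at hx'
        refine hcon x ⟨hx, ?_⟩
        simp only [mem_iInter, mem_ofPred_eq]
        intro φ hφ
        have := hx' φ.1 (by simpa using hφ)
        linarith)
    obtain ⟨x, hx, hx1⟩ := hSC φ hφ
    have hxK : x ∈ K := hSK (mem_insert_of_mem _ hx)
    have hnK : -x ∈ K := (hKabs.1.neg_mem_iff).2 hxK
    have h2 := h x hxK
    have h3 := h _ hnK
    simp only [map_neg] at h3
    exact absurd hx1 (not_lt.2 (abs_le.2 ⟨by linarith, by linarith⟩))
  obtain ⟨x, _, hx⟩ := key
  simp only [mem_iInter, mem_ofPred_eq] at hx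
  exact ⟨x, fun φ hφ => hx ⟨φ, hφ⟩⟩

end KreinSmulian

namespace QuasiSure

noncomputable section

variable {Ω : Type u} [MeasurableSpace Ω] {𝔓 : Set (ProbabilityMeasure Ω)}

/-! ### Quasi-sure calculus in `L^∞_c` -/

theorem dominatedBy_iff {μ : Measure Ω} : DominatedBy 𝔓 μ ↔ μ ≪ polarMeasure 𝔓 := by
  constructor
  · intro h
    refine Measure.AbsolutelyContinuous.mk fun N hN h0 => h N hN ((polarMeasure_eq_zero_iff 𝔓 hN).1 h0)
  · intro h N hN h0
    exact h ((polarMeasure_eq_zero_iff 𝔓 hN).2 h0)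

theorem absolutelyContinuous_polarMeasure {P : ProbabilityMeasure Ω} (hP : P ∈ 𝔓) :
    (P : Measure Ω) ≪ polarMeasure 𝔓 :=
  (Measure.le_sum (fun P : 𝔓 => ((P : ProbabilityMeasure Ω) : Measure Ω)) ⟨P, hP⟩).absolutelyContinuous

theorem ae_polarMeasure_iff {p : Ω → Prop} (hp : MeasurableSet {ω | p ω}) :
    (∀ᵐ ω ∂polarMeasure 𝔓, p ω) ↔ ∀ P ∈ 𝔓, ∀ᵐ ω ∂(P : Measure Ω), p ω := by
  rw [polarMeasure, Measure.ae_sum_iff' hp]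
  simp

theorem ae_norm_le (X : Linf 𝔓) : ∀ᵐ ω ∂polarMeasure 𝔓, ‖X ω‖ ≤ ‖X‖ := by
  have hfin : eLpNormEssSup X (polarMeasure 𝔓) ≠ ∞ := by
    simpa using Lp.eLpNorm_ne_top X
  filter_upwards [ae_le_eLpNormEssSup (f := X) (μ := polarMeasure 𝔓)] with ω hω
  have h2 := ENNReal.toReal_mono hfin hω
  rw [toReal_enorm] at h2
  rwa [Lp.norm_def, eLpNorm_exponent_top]

theorem norm_le_of_ae {X : Linf 𝔓} {m : ℝ} (hm : 0 ≤ m)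
    (h : ∀ᵐ ω ∂polarMeasure 𝔓, ‖X ω‖ ≤ m) : ‖X‖ ≤ m := by
  rw [Lp.norm_def, eLpNorm_exponent_top]
  exact ENNReal.toReal_le_of_le_ofReal hm (eLpNormEssSup_le_of_ae_bound h)

theorem Linf.measurable (X : Linf 𝔓) : Measurable (X : Ω → ℝ) :=
  (Lp.stronglyMeasurable X).measurable

theorem Linf.integrable (X : Linf 𝔓) {μ : Measure Ω} [IsFiniteMeasure μ]
    (h : μ ≪ polarMeasure 𝔓) : Integrable X μ :=
  Integrable.of_bound X.measurable.aestronglyMeasurable ‖X‖ (h.ae_le (ae_norm_le X))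

/-- The class of a bounded measurable function. -/
def ofBdd (𝔓 : Set (ProbabilityMeasure Ω)) (f : Ω → ℝ) (hf : Measurable f) (m : ℝ)
    (h : ∀ ω, |f ω| ≤ m) : Linf 𝔓 :=
  (memLp_top_of_bound hf.aestronglyMeasurable m (.of_forall h)).toLp f

theorem coeFn_ofBdd {f : Ω → ℝ} (hf : Measurable f) {m : ℝ} (h : ∀ ω, |f ω| ≤ m) :
    ofBdd 𝔓 f hf m h =ᵐ[polarMeasure 𝔓] f := MemLp.coeFn_toLp _

theorem coeFn_constLinf (m : ℝ) : constLinf 𝔓 m =ᵐ[polarMeasure 𝔓] fun _ => m :=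
  MemLp.coeFn_toLp _

theorem Linf.ext_ae {X Y : Linf 𝔓} (h : X =ᵐ[polarMeasure 𝔓] Y) : X = Y := Lp.ext h

theorem Linf.le_iff {X Y : Linf 𝔓} : X ≤ Y ↔ ∀ᵐ ω ∂polarMeasure 𝔓, X ω ≤ Y ω :=
  (Lp.coeFn_le X Y).symm

theorem Linf.add_constLinf (X : Linf 𝔓) (m : ℝ) :
    ∀ᵐ ω ∂polarMeasure 𝔓, (X + constLinf 𝔓 m) ω = X ω + m := by
  filter_upwards [Lp.coeFn_add X (constLinf 𝔓 m), coeFn_constLinf (𝔓 := 𝔓) m] with ω h1 h2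
  rw [h1, Pi.add_apply, h2]

theorem Linf.le_constLinf_iff {X : Linf 𝔓} {m : ℝ} :
    X ≤ constLinf 𝔓 m ↔ ∀ᵐ ω ∂polarMeasure 𝔓, X ω ≤ m := by
  rw [Linf.le_iff]
  constructor <;> intro h <;>
  filter_upwards [h, coeFn_constLinf (𝔓 := 𝔓) m] with ω h1 h2
  · rwa [← h2]
  · rwa [h2]

/-- Restrictions of the `P ∈ 𝔓` to events belong to `ca_c`, so this makes the order of `L^∞_c`
visible to the pairing with `ca_c`. -/
theorem Linf.le_of_forall_setIntegral_le {X Y : Linf 𝔓}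
    (h : ∀ P ∈ 𝔓, ∀ A, MeasurableSet A →
      ∫ ω in A, X ω ∂(P : Measure Ω) ≤ ∫ ω in A, Y ω ∂(P : Measure Ω)) : X ≤ Y := by
  rw [Linf.le_iff, ae_polarMeasure_iff (measurableSet_le X.measurable Y.measurable)]
  intro P hP
  exact ae_le_of_forall_setIntegral_le (X.integrable (absolutelyContinuous_polarMeasure hP))
    (Y.integrable (absolutelyContinuous_polarMeasure hP)) fun A hA _ => h P hP A hA

theorem Linf.integral_mono {X Y : Linf 𝔓} (hXY : X ≤ Y) {μ : Measure Ω} [IsFiniteMeasure μ]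
    (h : μ ≪ polarMeasure 𝔓) : ∫ ω, X ω ∂μ ≤ ∫ ω, Y ω ∂μ :=
  integral_mono_ae (X.integrable h) (Y.integrable h) (h.ae_le (Linf.le_iff.1 hXY))

theorem Linf.integral_add (X Y : Linf 𝔓) {μ : Measure Ω} [IsFiniteMeasure μ]
    (h : μ ≪ polarMeasure 𝔓) : ∫ ω, (X + Y) ω ∂μ = ∫ ω, X ω ∂μ + ∫ ω, Y ω ∂μ := by
  rw [← MeasureTheory.integral_add (X.integrable h) (Y.integrable h)]
  exact integral_congr_ae (h.ae_le (Lp.coeFn_add X Y))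

theorem Linf.integral_sub (X Y : Linf 𝔓) {μ : Measure Ω} [IsFiniteMeasure μ]
    (h : μ ≪ polarMeasure 𝔓) : ∫ ω, (X - Y) ω ∂μ = ∫ ω, X ω ∂μ - ∫ ω, Y ω ∂μ := by
  rw [← MeasureTheory.integral_sub (X.integrable h) (Y.integrable h)]
  exact integral_congr_ae (h.ae_le (Lp.coeFn_sub X Y))

theorem Linf.integral_smul (c : ℝ) (X : Linf 𝔓) {μ : Measure Ω}
    (h : μ ≪ polarMeasure 𝔓) : ∫ ω, (c • X) ω ∂μ = c * ∫ ω, X ω ∂μ := by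
  rw [← MeasureTheory.integral_const_mul]
  exact integral_congr_ae (h.ae_le (Lp.coeFn_smul c X))

/-! ### Signed measures -/

/-- The Jordan decomposition is not additive in `μ`; the vector measure integral supplies linearity
in `μ`. -/
theorem signedIntegral_eq_integral {μ : SignedMeasure Ω} {f : Ω → ℝ}
    (hf : Integrable f μ.totalVariation) :
    signedIntegral μ f = μ.integral f (ContinuousLinearMap.lsmul ℝ ℝ).flip := by
  have hp : Integrable f μ.toJordanDecomposition.posPart :=
    hf.mono_measure (Measure.le_add_right le_rfl)
  have hn : Integrable f μ.toJordanDecomposition.negPart :=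
    hf.mono_measure (Measure.le_add_left le_rfl)
  conv_rhs => rw [← SignedMeasure.toSignedMeasure_toJordanDecomposition μ]
  rw [JordanDecomposition.toSignedMeasure, VectorMeasure.integral_sub_vectorMeasure]
  · simp [signedIntegral]
  · simpa [VectorMeasure.Integrable] using hp
  · simpa [VectorMeasure.Integrable] using hn

theorem mem_ca {μ : SignedMeasure Ω} : μ ∈ ca 𝔓 ↔ DominatedBy 𝔓 μ.totalVariation := Iff.rfl

theorem ca_totalVariation_ac (μ : ca 𝔓) :
    (μ : SignedMeasure Ω).totalVariation ≪ polarMeasure 𝔓 := dominatedBy_iff.1 μ.2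

theorem Linf.integrable_variation (X : Linf 𝔓) (μ : ca 𝔓) :
    (μ : SignedMeasure Ω).Integrable X := by
  rw [VectorMeasure.Integrable, ← SignedMeasure.totalVariation_eq_variation]
  exact X.integrable (ca_totalVariation_ac μ)

theorem signedIntegral_ca (X : Linf 𝔓) (μ : ca 𝔓) : signedIntegral (μ : SignedMeasure Ω) X =
    (μ : SignedMeasure Ω).integral X (ContinuousLinearMap.lsmul ℝ ℝ).flip :=
  signedIntegral_eq_integral (X.integrable (ca_totalVariation_ac μ))

theorem signedIntegral_add_left (X : Linf 𝔓) (μ ν : ca 𝔓) :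
    signedIntegral ((μ + ν : ca 𝔓) : SignedMeasure Ω) X =
      signedIntegral (μ : SignedMeasure Ω) X + signedIntegral (ν : SignedMeasure Ω) X := by
  rw [signedIntegral_ca, signedIntegral_ca, signedIntegral_ca, Submodule.coe_add,
    VectorMeasure.integral_add_vectorMeasure (X.integrable_variation μ) (X.integrable_variation ν)]

theorem signedIntegral_smul_left (X : Linf 𝔓) (c : ℝ) (μ : ca 𝔓) :
    signedIntegral ((c • μ : ca 𝔓) : SignedMeasure Ω) X =
      c * signedIntegral (μ : SignedMeasure Ω) X := by
  rw [signedIntegral_ca, signedIntegral_ca, Submodule.coe_smul,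
    VectorMeasure.integral_smul_vectorMeasure, smul_eq_mul]

theorem posPart_ac (μ : ca 𝔓) :
    (μ : SignedMeasure Ω).toJordanDecomposition.posPart ≪ polarMeasure 𝔓 :=
  (Measure.absolutelyContinuous_of_le (Measure.le_add_right le_rfl)).trans (ca_totalVariation_ac μ)

theorem negPart_ac (μ : ca 𝔓) :
    (μ : SignedMeasure Ω).toJordanDecomposition.negPart ≪ polarMeasure 𝔓 :=
  (Measure.absolutelyContinuous_of_le (Measure.le_add_left le_rfl)).trans (ca_totalVariation_ac μ)

theorem signedIntegral_add_right (X Y : Linf 𝔓) (μ : ca 𝔓) :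
    signedIntegral (μ : SignedMeasure Ω) (X + Y : Linf 𝔓) =
      signedIntegral (μ : SignedMeasure Ω) X + signedIntegral (μ : SignedMeasure Ω) Y := by
  rw [signedIntegral, signedIntegral, signedIntegral, Linf.integral_add _ _ (posPart_ac μ),
    Linf.integral_add _ _ (negPart_ac μ)]
  ring

theorem signedIntegral_smul_right (c : ℝ) (X : Linf 𝔓) (μ : ca 𝔓) :
    signedIntegral (μ : SignedMeasure Ω) (c • X : Linf 𝔓) =
      c * signedIntegral (μ : SignedMeasure Ω) X := by
  rw [signedIntegral, signedIntegral, Linf.integral_smul _ _ (posPart_ac μ),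
    Linf.integral_smul _ _ (negPart_ac μ)]
  ring

theorem abs_signedIntegral_le (X : Linf 𝔓) (μ : ca 𝔓) :
    |signedIntegral (μ : SignedMeasure Ω) X| ≤ ‖X‖ * ‖μ‖ := by
  set p := (μ : SignedMeasure Ω).toJordanDecomposition.posPart
  set n := (μ : SignedMeasure Ω).toJordanDecomposition.negPart
  have hp : |∫ ω, X ω ∂p| ≤ ‖X‖ * p.real univ :=
    norm_integral_le_of_norm_le_const ((posPart_ac μ).ae_le (ae_norm_le X))
  have hn : |∫ ω, X ω ∂n| ≤ ‖X‖ * n.real univ :=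
    norm_integral_le_of_norm_le_const ((negPart_ac μ).ae_le (ae_norm_le X))
  have h : ‖μ‖ = p.real univ + n.real univ := by
    rw [norm_ca_def, SignedMeasure.totalVariation, measureReal_add_apply]
  rw [h, mul_add]
  exact (abs_sub _ _).trans (add_le_add hp hn)

/-- Integration of a fixed element of `L^∞_c`, as a linear functional on `ca_c`. -/
def signedIntegralₗ (X : Linf 𝔓) : ca 𝔓 →ₗ[ℝ] ℝ where
  toFun μ := signedIntegral (μ : SignedMeasure Ω) X
  map_add' := signedIntegral_add_left X
  map_smul' := signedIntegral_smul_left X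

/-- Integration of a fixed element of `L^∞_c`, as a bounded linear functional on `ca_c`. -/
def signedIntegralL (X : Linf 𝔓) : StrongDual ℝ (ca 𝔓) :=
  (signedIntegralₗ X).mkContinuous ‖X‖ (abs_signedIntegral_le X)

/-- The pairing of `L^∞_c` with `ca_c` given by integration. -/
def pairing (𝔓 : Set (ProbabilityMeasure Ω)) : Linf 𝔓 →ₗ[ℝ] StrongDual ℝ (ca 𝔓) where
  toFun X := signedIntegralL X
  map_add' X Y := by ext μ; exact signedIntegral_add_right X Y μ
  map_smul' c X := by ext μ; exact signedIntegral_smul_right c X μ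

theorem pairing_apply (X : Linf 𝔓) (μ : ca 𝔓) :
    pairing 𝔓 X μ = signedIntegral (μ : SignedMeasure Ω) X := rfl

theorem norm_pairing_le (X : Linf 𝔓) : ‖pairing 𝔓 X‖ ≤ ‖X‖ :=
  LinearMap.mkContinuous_norm_le (signedIntegralₗ X) (norm_nonneg X) (abs_signedIntegral_le X)

/-- A finite measure that does not charge polar events, as an element of `ca_c`. -/
def toCa (μ : Measure Ω) [IsFiniteMeasure μ] (h : μ ≪ polarMeasure 𝔓) : ca 𝔓 :=
  ⟨μ.toSignedMeasure, by
    rw [mem_ca, SignedMeasure.totalVariation_eq_variation, Measure.variation_toSignedMeasure]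
    exact dominatedBy_iff.2 h⟩

theorem norm_toCa (μ : Measure Ω) [IsFiniteMeasure μ] (h : μ ≪ polarMeasure 𝔓) :
    ‖toCa μ h‖ = μ.real univ := by
  rw [norm_ca_def, toCa, SignedMeasure.totalVariation_eq_variation,
    Measure.variation_toSignedMeasure]

theorem pairing_toCa (X : Linf 𝔓) (μ : Measure Ω) [IsFiniteMeasure μ]
    (h : μ ≪ polarMeasure 𝔓) : pairing 𝔓 X (toCa μ h) = ∫ ω, X ω ∂μ := by
  rw [pairing_apply, signedIntegral_ca, toCa, VectorMeasure.integral_toSignedMeasure]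

theorem ca_eq_sub (μ : ca 𝔓) : μ = toCa _ (posPart_ac μ) - toCa _ (negPart_ac μ) :=
  Subtype.ext (SignedMeasure.toSignedMeasure_toJordanDecomposition _).symm

/-- Testing on `P` restricted to `A` gives `|∫_A X dP| ≤ m P(A)` for all `A` and all `P ∈ 𝔓`, which
forces `|X| ≤ m` quasi surely. -/
theorem norm_pairing (X : Linf 𝔓) : ‖pairing 𝔓 X‖ = ‖X‖ := by
  refine le_antisymm (norm_pairing_le X) ?_
  set m := ‖pairing 𝔓 X‖ with hm
  have key : ∀ P ∈ 𝔓, ∀ A, MeasurableSet A → |∫ ω in A, X ω ∂(P : Measure Ω)| ≤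
      m * (P : Measure Ω).real A := by
    intro P hP A hA
    have hac : (P : Measure Ω).restrict A ≪ polarMeasure 𝔓 :=
      Measure.restrict_le_self.absolutelyContinuous.trans
        (absolutelyContinuous_polarMeasure hP)
    have := (pairing 𝔓 X).le_opNorm (toCa ((P : Measure Ω).restrict A) hac)
    rwa [pairing_toCa, norm_toCa, measureReal_restrict_apply_univ] at this
  have h1 : X ≤ constLinf 𝔓 m := by
    refine Linf.le_of_forall_setIntegral_le fun P hP A hA => ?_
    rw [integral_congr_ae (ae_restrict_of_ae ((absolutelyContinuous_polarMeasure hP).ae_le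
      (coeFn_constLinf (𝔓 := 𝔓) m))), setIntegral_const, smul_eq_mul, mul_comm]
    exact (abs_le.1 (key P hP A hA)).2
  have h2 : constLinf 𝔓 (-m) ≤ X := by
    refine Linf.le_of_forall_setIntegral_le fun P hP A hA => ?_
    rw [integral_congr_ae (ae_restrict_of_ae ((absolutelyContinuous_polarMeasure hP).ae_le
      (coeFn_constLinf (𝔓 := 𝔓) (-m)))), setIntegral_const, smul_eq_mul,
      mul_comm, neg_mul]
    exact (abs_le.1 (key P hP A hA)).1
  refine norm_le_of_ae (norm_nonneg _) ?_
  filter_upwards [Linf.le_constLinf_iff.1 h1, Linf.le_iff.1 h2, coeFn_constLinf (𝔓 := 𝔓) (-m)]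
    with ω h3 h4 h5
  rw [h5] at h4
  exact abs_le.2 ⟨h4, h3⟩

/-! ### Densities -/

/-- The signed measure with density `f` with respect to `Q`, as an element of `ca_c`. -/
def densCa (Q : Measure Ω) [IsFiniteMeasure Q] (h : Q ≪ polarMeasure 𝔓) (f : Ω → ℝ) : ca 𝔓 :=
  ⟨Q.withDensityᵥ f, by
    rw [mem_ca, SignedMeasure.totalVariation_eq_variation]
    refine dominatedBy_iff.2 ?_
    by_cases hf : Integrable f Q
    · rw [Measure.variation_withDensityᵥ hf]
      exact (withDensity_absolutelyContinuous _ _).trans h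
    -- A density that is not integrable gives the zero measure by convention.
    · rw [Measure.withDensityᵥ, dif_neg hf, VectorMeasure.variation_zero]
      exact Measure.AbsolutelyContinuous.zero _⟩

section Densities

variable {Q : Measure Ω} [IsFiniteMeasure Q] (hQ : Q ≪ polarMeasure 𝔓)

theorem norm_densCa {f : Ω → ℝ} (hf : Integrable f Q) : ‖densCa Q hQ f‖ = ∫ ω, ‖f ω‖ ∂Q := by
  rw [norm_ca_def, densCa, SignedMeasure.totalVariation_eq_variation,
    Measure.variation_withDensityᵥ hf, Measure.real, withDensity_apply _ MeasurableSet.univ,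
    Measure.restrict_univ, integral_norm_eq_lintegral_enorm hf.aestronglyMeasurable]

theorem densCa_add {f g : Ω → ℝ} (hf : Integrable f Q) (hg : Integrable g Q) :
    densCa Q hQ (f + g) = densCa Q hQ f + densCa Q hQ g :=
  Subtype.ext (withDensityᵥ_add hf hg)

theorem densCa_sub {f g : Ω → ℝ} (hf : Integrable f Q) (hg : Integrable g Q) :
    densCa Q hQ (f - g) = densCa Q hQ f - densCa Q hQ g :=
  Subtype.ext (withDensityᵥ_sub hf hg)

theorem densCa_smul (c : ℝ) (f : Ω → ℝ) : densCa Q hQ (c • f) = c • densCa Q hQ f :=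
  Subtype.ext (withDensityᵥ_smul f c)

theorem densCa_congr {f g : Ω → ℝ} (h : f =ᵐ[Q] g) : densCa Q hQ f = densCa Q hQ g :=
  Subtype.ext (WithDensityᵥEq.congr_ae h)

theorem pairing_densCa (X : Linf 𝔓) {f : Ω → ℝ} (hf : Integrable f Q) :
    pairing 𝔓 X (densCa Q hQ f) = ∫ ω, f ω * X ω ∂Q := by
  have hpf : IsFiniteMeasure (Q.withDensity fun ω => ENNReal.ofReal (f ω)) :=
    isFiniteMeasure_withDensity_ofReal hf.2
  have hnf : IsFiniteMeasure (Q.withDensity fun ω => ENNReal.ofReal (-f ω)) :=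
    isFiniteMeasure_withDensity_ofReal hf.neg.2
  have hp : (Q.withDensity fun ω => ENNReal.ofReal (f ω)) ≪ polarMeasure 𝔓 :=
    (withDensity_absolutelyContinuous _ _).trans hQ
  have hn : (Q.withDensity fun ω => ENNReal.ofReal (-f ω)) ≪ polarMeasure 𝔓 :=
    (withDensity_absolutelyContinuous _ _).trans hQ
  have h : densCa Q hQ f = toCa _ hp - toCa _ hn :=
    Subtype.ext (withDensityᵥ_eq_withDensity_pos_part_sub_withDensity_neg_part hf)
  have hX : ∀ g : Ω → ℝ, Integrable g Q → Integrable (fun ω => (ENNReal.ofReal (g ω)).toReal * X ω) Q := by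
    intro g hg
    refine Integrable.mul_bdd (c := ‖X‖) ?_ X.measurable.aestronglyMeasurable (hQ.ae_le (ae_norm_le X))
    simpa [ENNReal.toReal_ofReal'] using hg.pos_part
  rw [h, map_sub, pairing_toCa, pairing_toCa,
    integral_withDensity_eq_integral_toReal_smul₀ hf.aemeasurable.ennreal_ofReal (by simp),
    integral_withDensity_eq_integral_toReal_smul₀ (f := fun ω => ENNReal.ofReal (-f ω)) hf.neg.aemeasurable.ennreal_ofReal (by simp)]
  simp only [smul_eq_mul]
  rw [← MeasureTheory.integral_sub (hX _ hf) (hX (fun ω => -f ω) hf.neg)]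
  refine integral_congr_ae (.of_forall fun ω => ?_)
  simp only [ENNReal.toReal_ofReal', ← sub_mul]
  rcases le_total 0 (f ω) with h | h <;> simp [h]

theorem toCa_eq_densCa {μ : Measure Ω} [IsFiniteMeasure μ] (h : μ ≪ Q) :
    toCa μ (h.trans hQ) = densCa Q hQ fun ω => (μ.rnDeriv Q ω).toReal := by
  refine Subtype.ext ?_
  have h1 := withDensityᵥ_toReal (Measure.measurable_rnDeriv μ Q).aemeasurable
    (Measure.lintegral_rnDeriv_lt_top μ Q).ne
  simp_rw [Measure.withDensity_rnDeriv_eq μ Q h] at h1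
  exact h1.symm

end Densities

/-! ### Completeness of `ca_c` -/

theorem toCa_add {μ ν : Measure Ω} [IsFiniteMeasure μ] [IsFiniteMeasure ν]
    (hμ : μ ≪ polarMeasure 𝔓) (hν : ν ≪ polarMeasure 𝔓) :
    toCa (μ + ν) (hμ.add_left hν) = toCa μ hμ + toCa ν hν :=
  Subtype.ext (Measure.toSignedMeasure_add μ ν)

theorem toCa_congr {μ ν : Measure Ω} [IsFiniteMeasure μ] [IsFiniteMeasure ν] (h : μ = ν)
    (hμ : μ ≪ polarMeasure 𝔓) (hν : ν ≪ polarMeasure 𝔓) : toCa μ hμ = toCa ν hν := by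
  subst h; rfl

theorem isFiniteMeasure_sum_add {p : ℕ → Measure Ω} (hfin : ∑' n, p n univ ≠ ∞) (n : ℕ) :
    IsFiniteMeasure (Measure.sum fun i => p (i + n)) := by
  refine ⟨?_⟩
  rw [Measure.sum_apply _ MeasurableSet.univ]
  exact (ENNReal.tsum_comp_le_tsum_of_injective (add_left_injective n) _).trans_lt hfin.lt_top

theorem sum_add_absolutelyContinuous {p : ℕ → Measure Ω} (hp : ∀ n, p n ≪ polarMeasure 𝔓) (n : ℕ) :
    (Measure.sum fun i => p (i + n)) ≪ polarMeasure 𝔓 :=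
  Measure.absolutelyContinuous_sum_left fun i => hp (i + n)

/-- Partial sums telescope into differences of tail measures, whose norms are the tails of a
convergent series of masses. -/
theorem tendsto_sum_toCa {p : ℕ → Measure Ω} [∀ n, IsFiniteMeasure (p n)]
    (hp : ∀ n, p n ≪ polarMeasure 𝔓) (hfin : ∑' n, p n univ ≠ ∞) :
    ∃ a : ca 𝔓, Tendsto (fun n => ∑ i ∈ Finset.range n, toCa (p i) (hp i)) atTop (nhds a) := by
  have hf := isFiniteMeasure_sum_add hfin
  have hac := sum_add_absolutelyContinuous hp
  let R : ℕ → ca 𝔓 := fun n => toCa _ (hac n)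
  have hR : ∀ n, R n = toCa (p n) (hp n) + R (n + 1) := by
    intro n
    rw [← toCa_add]
    refine toCa_congr (Measure.ext fun s hs => ?_) _ _
    rw [Measure.add_apply, Measure.sum_apply _ hs, Measure.sum_apply _ hs,
      tsum_eq_zero_add' ENNReal.summable]
    simp [add_assoc, add_comm 1 n]
  have hsum : ∀ n, ∑ i ∈ Finset.range n, toCa (p i) (hp i) = R 0 - R n := by
    intro n
    induction n with
    | zero => simp
    | succ n ih => rw [Finset.sum_range_succ, ih, hR n]; abel
  refine ⟨R 0, ?_⟩
  simp_rw [hsum]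
  have hR0 : Tendsto R atTop (nhds 0) := by
    rw [tendsto_zero_iff_norm_tendsto_zero]
    have h1 : ∀ n, ‖R n‖ = (∑' i, p (i + n) univ).toReal := fun n => by
      rw [norm_toCa, Measure.real, Measure.sum_apply _ MeasurableSet.univ]
    simp_rw [h1]
    rw [← ENNReal.toReal_zero, ENNReal.tendsto_toReal_iff _ ENNReal.zero_ne_top]
    · exact ENNReal.tendsto_sum_nat_add _ hfin
    · intro n
      exact ((ENNReal.tsum_comp_le_tsum_of_injective (add_left_injective n)
        fun i => p i univ).trans_lt hfin.lt_top).ne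
  simpa using tendsto_const_nhds.sub hR0

/-- An absolutely summable series splits into its positive and negative Jordan parts, two series of
measures with summable masses. Completeness is what the Krein–Šmulian argument requires of the
predual. -/
instance instCompleteSpaceCa : CompleteSpace (ca 𝔓) := by
  refine NormedAddCommGroup.completeSpace_of_summable_imp_tendsto fun v hv => ?_
  have hfin : ∑' n, (v n : SignedMeasure Ω).totalVariation univ ≠ ∞ := by
    have h : ∀ n, (v n : SignedMeasure Ω).totalVariation univ = ENNReal.ofReal ‖v n‖ := fun n => by
      rw [norm_ca_def, ofReal_measureReal]
    simp_rw [h]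
    exact hv.tsum_ofReal_ne_top
  obtain ⟨a, ha⟩ := tendsto_sum_toCa (fun n => posPart_ac (v n)) (ne_top_of_le_ne_top hfin
    (ENNReal.tsum_le_tsum fun n => Measure.le_add_right le_rfl univ))
  obtain ⟨b, hb⟩ := tendsto_sum_toCa (fun n => negPart_ac (v n)) (ne_top_of_le_ne_top hfin
    (ENNReal.tsum_le_tsum fun n => Measure.le_add_left le_rfl univ))
  refine ⟨a - b, (ha.sub hb).congr fun n => ?_⟩
  rw [← Finset.sum_sub_distrib]
  exact Finset.sum_congr rfl fun i _ => (ca_eq_sub (v i)).symm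

/-! ### Order continuity and supports -/

/-- Order continuity of the expectation under `Q`. -/
def OrderContinuous (𝔓 : Set (ProbabilityMeasure Ω)) (Q : Measure Ω) : Prop :=
  ∀ (I : Type u) [Preorder I] [Nonempty I] [IsDirectedOrder I] (y : I → Linf 𝔓),
    Antitone y → IsGLB (range y) 0 → Tendsto (fun i => ∫ ω, y i ω ∂Q) atTop (nhds 0)

/-- Decreasing integrals converge for every measure; only their limit has to be identified. By
weak-* compactness the limit functional is integration of some `X`, which is a lower bound of the
net, so `X ≤ 0`. -/
theorem orderContinuous_of_dual (h : DualOfCaIsLinf 𝔓) (Q : Measure Ω) [IsFiniteMeasure Q]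
    (hQ : Q ≪ polarMeasure 𝔓) : OrderContinuous 𝔓 Q := by
  obtain ⟨e, he⟩ := h
  intro I _ _ _ y hy hglb
  have he' : ∀ X, e X = pairing 𝔓 X := fun X => by ext μ; exact he X μ
  have hy0 : ∀ i, 0 ≤ y i := fun i => hglb.1 ⟨i, rfl⟩
  have hlim : ∀ (μ : Measure Ω) [IsFiniteMeasure μ], μ ≪ polarMeasure 𝔓 →
      Tendsto (fun i => ∫ ω, y i ω ∂μ) atTop (nhds (⨅ i, ∫ ω, y i ω ∂μ)) := by
    intro μ _ hμ
    refine tendsto_atTop_ciInf (fun i j hij => Linf.integral_mono (hy hij) hμ) ⟨0, ?_⟩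
    rintro _ ⟨i, rfl⟩
    have := Linf.integral_mono (hy0 i) hμ
    rwa [integral_congr_ae (hμ.ae_le (Lp.coeFn_zero ..)), Pi.zero_def, integral_zero] at this
  let i0 : I := Classical.arbitrary I
  have hbdd : ∀ i, i0 ≤ i → ‖y i‖ ≤ ‖y i0‖ := fun i hi =>
    norm_le_norm_of_abs_le_abs (by rw [abs_of_nonneg (hy0 i), abs_of_nonneg (hy0 i0)]; exact hy hi)
  -- An ultrafilter finer than `atTop` suffices, since the limits along `atTop` already exist for
  -- each measure.
  let U : Ultrafilter I := Ultrafilter.of atTop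
  have hU : (U : Filter I) ≤ atTop := Ultrafilter.of_le _
  let F : I → WeakDual ℝ (ca 𝔓) := fun i => StrongDual.toWeakDual (pairing 𝔓 (y i))
  obtain ⟨φ, _, hφ⟩ := (WeakDual.isCompact_closedBall (𝕜 := ℝ) (E := ca 𝔓) 0 ‖y i0‖).ultrafilter_le_nhds
    (U.map F) (by
      rw [le_principal_iff, Ultrafilter.coe_map, mem_map]
      filter_upwards [hU (eventually_ge_atTop i0)] with i hi
      have : ‖pairing 𝔓 (y i)‖ ≤ ‖y i0‖ := (norm_pairing_le _).trans (hbdd i hi)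
      simpa [F] using this)
  obtain ⟨X, hX⟩ := e.surjective (WeakDual.toStrongDual φ)
  have hUlim : ∀ (μ : Measure Ω) [IsFiniteMeasure μ], (hμ : μ ≪ polarMeasure 𝔓) →
      ∫ ω, X ω ∂μ = ⨅ i, ∫ ω, y i ω ∂μ := by
    intro μ _ hμ
    have h1 : Tendsto (fun i => F i (toCa μ hμ)) U (nhds (φ (toCa μ hμ))) :=
      ((WeakDual.eval_continuous (toCa μ hμ)).tendsto φ).comp hφ
    have h2 : φ (toCa μ hμ) = ∫ ω, X ω ∂μ := by
      rw [← pairing_toCa X μ hμ, ← he', hX]; rfl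
    have h3 : ∀ i, F i (toCa μ hμ) = ∫ ω, y i ω ∂μ := fun i => pairing_toCa (y i) μ hμ
    simp_rw [h3, h2] at h1
    exact tendsto_nhds_unique h1 ((hlim μ hμ).mono_left hU)
  have hXle : X ≤ 0 := by
    refine hglb.2 ?_
    rintro _ ⟨i, rfl⟩
    refine Linf.le_of_forall_setIntegral_le fun P hP A hA => ?_
    have hac : (P : Measure Ω).restrict A ≪ polarMeasure 𝔓 :=
      Measure.restrict_le_self.absolutelyContinuous.trans (absolutelyContinuous_polarMeasure hP)
    rw [hUlim _ hac]
    exact (show Antitone fun i => ∫ ω in A, y i ω ∂(P : Measure Ω) from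
      fun i j hij => Linf.integral_mono (hy hij) hac).le_of_tendsto (hlim _ hac) i
  have h0 := Linf.integral_mono hXle hQ
  rw [integral_congr_ae (hQ.ae_le (Lp.coeFn_zero ..)), Pi.zero_def, integral_zero, hUlim Q hQ] at h0
  have h1 : (0 : ℝ) ≤ ⨅ i, ∫ ω, y i ω ∂Q := by
    refine le_ciInf fun i => ?_
    have := Linf.integral_mono (hy0 i) hQ
    rwa [integral_congr_ae (hQ.ae_le (Lp.coeFn_zero ..)), Pi.zero_def, integral_zero] at this
  have := hlim Q hQ
  rwa [le_antisymm h0 h1] at this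

/-- The expectation under `Q`, as a functional on `L^∞_c`, is a convex risk measure. -/
theorem isConvexRiskMeasure_integral (Q : ProbabilityMeasure Ω)
    (hQ : (Q : Measure Ω) ≪ polarMeasure 𝔓) :
    IsConvexRiskMeasure 𝔓 fun X => ∫ ω, X ω ∂(Q : Measure Ω) where
  convex := ⟨convex_univ, fun X _ Y _ a b _ _ _ => by
    beta_reduce
    rw [Linf.integral_add _ _ hQ, Linf.integral_smul _ _ hQ, Linf.integral_smul _ _ hQ]; rfl⟩
  monotone X Y h := Linf.integral_mono h hQ
  cash_additive X m := by
    rw [Linf.integral_add _ _ hQ, integral_congr_ae (hQ.ae_le (coeFn_constLinf m))]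
    simp

theorem hasRobustRepresentation_integral (Q : ProbabilityMeasure Ω)
    (hQ : (Q : Measure Ω) ≪ polarMeasure 𝔓) :
    HasRobustRepresentation 𝔓 fun X => ∫ ω, X ω ∂(Q : Measure Ω) := by
  classical
  let Q' : DominatedProb 𝔓 := ⟨Q, dominatedBy_iff.2 hQ⟩
  refine ⟨fun R => if R = Q' then 0 else ⊤, ⟨0, fun R => ?_⟩, ⟨Q', by simp⟩, fun X => ?_⟩
  · beta_reduce
    split_ifs <;> simp
  · refine le_antisymm ?_ (iSup_le fun R => ?_)
    · refine le_trans ?_ (le_iSup _ Q')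
      simp [Q']
    · by_cases h : R = Q'
      · simp [h, Q']
      · simp [h]

/-- The Fatou property along `-y i`, which converges in order to `0`, bounds the positive numbers `∫
y i dQ` from above in the limit. -/
theorem orderContinuous_of_hasFatouProperty (Q : ProbabilityMeasure Ω)
    (hQ : (Q : Measure Ω) ≪ polarMeasure 𝔓)
    (h : HasFatouProperty 𝔓 fun X => ∫ ω, X ω ∂(Q : Measure Ω)) :
    OrderContinuous 𝔓 (Q : Measure Ω) := by
  intro I _ _ _ y hy hglb
  have hy0 : ∀ i, 0 ≤ y i := fun i => hglb.1 ⟨i, rfl⟩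
  have hz : ∫ ω, (0 : Linf 𝔓) ω ∂(Q : Measure Ω) = 0 := by
    rw [integral_congr_ae (hQ.ae_le (Lp.coeFn_zero ..)), Pi.zero_def, integral_zero]
  have hint : ∀ i, 0 ≤ ∫ ω, y i ω ∂(Q : Measure Ω) := fun i =>
    hz.symm.trans_le (Linf.integral_mono (hy0 i) hQ)
  have hF := h I (fun i => -y i) 0 ⟨y, hy, hglb, fun i => by
    rw [sub_zero, abs_neg, abs_of_nonneg (hy0 i)]⟩
  have hneg : ∀ i, ∫ ω, (-y i) ω ∂(Q : Measure Ω) = -∫ ω, y i ω ∂(Q : Measure Ω) := fun i => by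
    rw [integral_congr_ae (hQ.ae_le (Lp.coeFn_neg (y i)))]
    exact integral_neg _
  simp only [hz, hneg] at hF
  refine tendsto_order.2 ⟨fun a ha => .of_forall fun i => ha.trans_le (hint i), fun a ha => ?_⟩
  have h1 : ((-a : ℝ) : EReal) < liminf
      (fun i => ((-∫ ω, y i ω ∂(Q : Measure Ω) : ℝ) : EReal)) atTop :=
    lt_of_lt_of_le (by exact_mod_cast neg_lt_zero.2 ha) hF
  filter_upwards [eventually_lt_of_lt_liminf h1] with i hi
  have := EReal.coe_lt_coe_iff.1 hi
  linarith

/-- Let `V` be the supremum of the indicators of `Q`-null events. Order continuity along `V - 1_N`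
gives `∫ V dQ = 0`, so `Q` lives on `S = {V ≤ 0}`. A `Q`-null `A ⊆ S` satisfies `1 ≤ V ≤ 0` quasi
surely on `A`, hence is polar. -/
theorem exists_support (hDC : IsDedekindComplete (Linf 𝔓)) {Q : Measure Ω} [IsFiniteMeasure Q]
    (hQ : Q ≪ polarMeasure 𝔓) (hoc : OrderContinuous 𝔓 Q) :
    ∃ S, MeasurableSet S ∧ Q Sᶜ = 0 ∧
      ∀ A, MeasurableSet A → A ⊆ S → Q A = 0 → polarMeasure 𝔓 A = 0 := by
  classical
  let I := {N : Set Ω // MeasurableSet N ∧ Q N = 0}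
  have : Nonempty I := ⟨⟨∅, MeasurableSet.empty, measure_empty⟩⟩
  have : IsDirectedOrder I := ⟨fun A B => ⟨⟨A.1 ∪ B.1, A.2.1.union B.2.1,
    measure_union_null A.2.2 B.2.2⟩, subset_union_left, subset_union_right⟩⟩
  let x : I → Linf 𝔓 := fun N => ofBdd 𝔓 (N.1.indicator fun _ => 1)
    (measurable_const.indicator N.2.1) 1 (fun ω => by
      by_cases h : ω ∈ N.1 <;> simp [h])
  have hx : ∀ N : I, x N =ᵐ[polarMeasure 𝔓] N.1.indicator fun _ => 1 := fun N => coeFn_ofBdd _ _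
  have hmono : Monotone x := by
    intro N M hNM
    rw [Linf.le_iff]
    filter_upwards [hx N, hx M] with ω h1 h2
    rw [h1, h2]
    exact indicator_le_indicator_of_subset hNM (fun _ => zero_le_one) ω
  obtain ⟨V, hV⟩ := hDC (range x) (range_nonempty _) ⟨constLinf 𝔓 1, by
    rintro _ ⟨N, rfl⟩
    rw [Linf.le_constLinf_iff]
    filter_upwards [hx N] with ω h1
    rw [h1]
    exact indicator_apply_le' (fun _ => le_rfl) fun _ => zero_le_one⟩
  have hglb : IsGLB (range fun N => V - x N) 0 := by
    refine ⟨?_, fun W hW => ?_⟩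
    · rintro _ ⟨N, rfl⟩
      exact sub_nonneg.2 (hV.1 ⟨N, rfl⟩)
    · have : V ≤ V - W := hV.2 (by
        rintro _ ⟨N, rfl⟩
        have := hW ⟨N, rfl⟩
        exact le_sub_comm.1 this)
      exact (le_sub_self_iff _).1 this
  have hlim := hoc I (fun N => V - x N) (fun N M h => sub_le_sub_left (hmono h) V) hglb
  have hxint : ∀ N : I, ∫ ω, x N ω ∂Q = 0 := fun N => by
    rw [integral_congr_ae (hQ.ae_le (hx N)), integral_indicator N.2.1]
    simp [N.2.2, Measure.restrict_eq_zero.2]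
  simp only [Linf.integral_sub _ _ hQ, hxint, sub_zero] at hlim
  have hVint : ∫ ω, V ω ∂Q = 0 := tendsto_nhds_unique tendsto_const_nhds hlim
  have hV0 : ∀ᵐ ω ∂polarMeasure 𝔓, 0 ≤ V ω := by
    have h1 := Linf.le_iff.1 (hV.1 ⟨⟨∅, MeasurableSet.empty, measure_empty⟩, rfl⟩)
    filter_upwards [h1, hx ⟨∅, MeasurableSet.empty, measure_empty⟩] with ω h2 h3
    rw [h3] at h2
    simpa using h2
  have hVae := (integral_eq_zero_iff_of_nonneg_ae (hQ.ae_le hV0) (V.integrable hQ)).1 hVint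
  refine ⟨{ω | V ω ≤ 0}, measurableSet_le V.measurable measurable_const, ?_, ?_⟩
  · rw [← mem_ae_iff]
    filter_upwards [hVae] with ω h
    exact h.le
  · intro A hA hAS hQA
    rw [measure_eq_zero_iff_ae_notMem]
    filter_upwards [Linf.le_iff.1 (hV.1 ⟨⟨A, hA, hQA⟩, rfl⟩), hx ⟨A, hA, hQA⟩] with ω h1 h2 hω
    rw [h2, indicator_of_mem hω] at h1
    exact absurd (h1.trans (hAS hω)) (by norm_num)

theorem OrderConverges.integral_le_add {I : Type*} [Preorder I] {X : I → Linf 𝔓} {Y : Linf 𝔓}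
    {y : I → Linf 𝔓} (h : ∀ i, |X i - Y| ≤ y i) {Q : Measure Ω} [IsFiniteMeasure Q]
    (hQ : Q ≪ polarMeasure 𝔓) (i : I) :
    ∫ ω, Y ω ∂Q ≤ ∫ ω, X i ω ∂Q + ∫ ω, y i ω ∂Q := by
  rw [← Linf.integral_add _ _ hQ]
  refine Linf.integral_mono ?_ hQ
  have := (neg_le_abs (X i - Y)).trans (h i)
  rw [neg_sub, sub_le_iff_le_add'] at this
  exact this

/-! ### Robust representations and level sets under order convergence -/

/-- Each penalised expectation is continuous along order convergent nets, and a supremum of such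
functionals is lower semicontinuous. -/
theorem hasFatouProperty_of_hasRobustRepresentation
    (hoc : ∀ Q : ProbabilityMeasure Ω, (Q : Measure Ω) ≪ polarMeasure 𝔓 →
      OrderContinuous 𝔓 (Q : Measure Ω))
    {ρ : Linf 𝔓 → ℝ} (h : HasRobustRepresentation 𝔓 ρ) : HasFatouProperty 𝔓 ρ := by
  obtain ⟨α, ⟨b, hb⟩, -, hα⟩ := h
  intro I _ _ _ X Y ⟨y, hy, hglb, hXy⟩
  rw [hα Y]
  refine iSup_le fun Q => ?_
  have hQ : (Q.1 : Measure Ω) ≪ polarMeasure 𝔓 := dominatedBy_iff.1 Q.2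
  induction hαQ : α Q with
  | bot => exact absurd (hb Q) (by simp [hαQ])
  | top => simp
  | coe a =>
    have hle : ∀ i, ((∫ ω, Y ω ∂(Q.1 : Measure Ω) - a - ∫ ω, y i ω ∂(Q.1 : Measure Ω) : ℝ) : EReal) ≤
        ρ (X i) := by
      intro i
      rw [hα (X i)]
      refine le_trans ?_ (le_iSup _ Q)
      rw [hαQ, ← EReal.coe_sub, EReal.coe_le_coe_iff]
      have := OrderConverges.integral_le_add hXy hQ i
      linarith
    have hlim : Tendsto (fun i => ((∫ ω, Y ω ∂(Q.1 : Measure Ω) - a -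
        ∫ ω, y i ω ∂(Q.1 : Measure Ω) : ℝ) : EReal)) atTop
        (nhds ((∫ ω, Y ω ∂(Q.1 : Measure Ω) - a : ℝ) : EReal)) := by
      refine (continuous_coe_real_ereal.tendsto _).comp ?_
      simpa using tendsto_const_nhds.sub (hoc Q.1 hQ I y hy hglb)
    rw [← EReal.coe_sub, ← hlim.liminf_eq]
    exact liminf_le_liminf (.of_forall hle)

/-- Monotonicity and cash-additivity applied to `X ≤ Y + ‖X - Y‖`; it keeps level sets away from a
ball in the separation argument. -/
theorem IsConvexRiskMeasure.sub_le_norm {ρ : Linf 𝔓 → ℝ} (hρ : IsConvexRiskMeasure 𝔓 ρ)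
    (X Y : Linf 𝔓) : ρ X - ρ Y ≤ ‖X - Y‖ := by
  have h : X ≤ Y + constLinf 𝔓 ‖X - Y‖ := by
    rw [Linf.le_iff]
    filter_upwards [Linf.add_constLinf Y ‖X - Y‖, ae_norm_le (X - Y), Lp.coeFn_sub X Y]
      with ω h1 h2 h3
    rw [h1]
    rw [h3, Pi.sub_apply] at h2
    linarith [le_of_abs_le h2]
  have := hρ.monotone h
  rw [hρ.cash_additive] at this
  linarith

/-- A level set of a function with the Fatou property is closed under order convergence. -/
theorem HasFatouProperty.le_of_orderConverges {ρ : Linf 𝔓 → ℝ} (hF : HasFatouProperty 𝔓 ρ)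
    {I : Type u} [Preorder I] [Nonempty I] [IsDirectedOrder I] {X : I → Linf 𝔓} {Y : Linf 𝔓}
    (h : OrderConverges X Y) {c : ℝ} (hc : ∀ i, ρ (X i) ≤ c) : ρ Y ≤ c := by
  have h1 := hF I X Y h
  rw [← EReal.coe_le_coe_iff]
  refine h1.trans ?_
  refine (liminf_le_liminf (v := fun _ => (c : EReal))
    (.of_forall fun i => EReal.coe_le_coe_iff.2 (hc i))).trans ?_
  rw [liminf_const]

theorem OrderConverges.add_right {I : Type*} [Preorder I] {X : I → Linf 𝔓} {Y : Linf 𝔓}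
    (h : OrderConverges X Y) (Z : Linf 𝔓) : OrderConverges (fun i => X i + Z) (Y + Z) := by
  obtain ⟨y, hy, hg, hl⟩ := h
  exact ⟨y, hy, hg, fun i => by simpa using hl i⟩

/-! ### From weak limits to order limits -/

/-- A uniformly bounded sequence of functions that converges quasi surely converges in order. -/
theorem orderConverges_of_ae_tendsto {f : ℕ → Ω → ℝ} {g : Ω → ℝ} (hf : ∀ n, Measurable (f n))
    (hg : Measurable g) {m : ℝ} (hfm : ∀ n ω, |f n ω| ≤ m) (hgm : ∀ ω, |g ω| ≤ m)
    (h : ∀ᵐ ω ∂polarMeasure 𝔓, Tendsto (fun n => f n ω) atTop (nhds (g ω))) :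
    OrderConverges (fun n : ULift.{u} ℕ => ofBdd 𝔓 (f n.down) (hf n.down) m (hfm n.down))
      (ofBdd 𝔓 g hg m hgm) := by
  -- The dominating sequence is the supremum of the tail errors: decreasing, and tending to `0`
  -- wherever `f n` converges to `g`.
  let d : ℕ → Ω → ℝ := fun n ω => ⨆ k, |f (n + k) ω - g ω|
  have hfg : ∀ k ω, |f k ω - g ω| ≤ 2 * m := fun k ω =>
    (abs_sub _ _).trans (by linarith [hfm k ω, hgm ω])
  have hbdd : ∀ n ω, BddAbove (range fun k => |f (n + k) ω - g ω|) := fun n ω =>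
    ⟨2 * m, by rintro _ ⟨k, rfl⟩; exact hfg _ ω⟩
  have hdm : ∀ n, Measurable (d n) := fun n =>
    Measurable.iSup fun k => ((hf _).sub hg).abs
  have hdb : ∀ n ω, |d n ω| ≤ 2 * m := fun n ω => by
    rw [abs_of_nonneg (Real.iSup_nonneg fun k => abs_nonneg _)]
    exact ciSup_le fun k => hfg _ ω
  have hle : ∀ n ω, |f n ω - g ω| ≤ d n ω := fun n ω => le_ciSup (hbdd n ω) 0
  have hanti : ∀ n j ω, n ≤ j → d j ω ≤ d n ω := by
    intro n j ω hnj
    refine ciSup_le fun k => ?_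
    have := le_ciSup (hbdd n ω) (j - n + k)
    rwa [← add_assoc, Nat.add_sub_cancel' hnj] at this
  refine ⟨fun n => ofBdd 𝔓 (d n.down) (hdm _) (2 * m) (hdb _), ?_, ⟨?_, ?_⟩, ?_⟩
  · intro n j hnj
    rw [Linf.le_iff]
    filter_upwards [coeFn_ofBdd (𝔓 := 𝔓) (hdm n.down) (hdb n.down),
      coeFn_ofBdd (𝔓 := 𝔓) (hdm j.down) (hdb j.down)] with ω h1 h2
    rw [h1, h2]
    exact hanti _ _ ω hnj
  · rintro _ ⟨n, rfl⟩
    rw [Linf.le_iff]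
    filter_upwards [coeFn_ofBdd (𝔓 := 𝔓) (hdm n.down) (hdb n.down),
      Lp.coeFn_zero ℝ ∞ (polarMeasure 𝔓)] with ω h1 h2
    rw [h1, h2]
    exact (abs_nonneg _).trans (hle _ ω)
  · intro W hW
    have hW' : ∀ᵐ ω ∂polarMeasure 𝔓, ∀ n, W ω ≤ d n ω := by
      rw [ae_all_iff]
      intro n
      filter_upwards [Linf.le_iff.1 (hW ⟨⟨n⟩, rfl⟩), coeFn_ofBdd (𝔓 := 𝔓) (hdm n) (hdb n)]
        with ω h1 h2
      rwa [h2] at h1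
    rw [Linf.le_iff]
    filter_upwards [hW', h, Lp.coeFn_zero ℝ ∞ (polarMeasure 𝔓)] with ω h1 h2 h3
    rw [h3]
    refine le_of_forall_pos_le_add fun ε hε => ?_
    obtain ⟨N, hN⟩ := Metric.tendsto_atTop.1 h2 ε hε
    refine (h1 N).trans ?_
    rw [Pi.zero_apply, zero_add]
    exact ciSup_le fun k => (hN (N + k) (Nat.le_add_right _ _)).le
  · intro n
    rw [Linf.le_iff]
    filter_upwards [coeFn_ofBdd (𝔓 := 𝔓) (hdm n.down) (hdb n.down),
      coeFn_ofBdd (𝔓 := 𝔓) (hf n.down) (hfm n.down), coeFn_ofBdd (𝔓 := 𝔓) hg hgm,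
      Lp.coeFn_abs (ofBdd 𝔓 (f n.down) (hf n.down) m (hfm n.down) - ofBdd 𝔓 g hg m hgm),
      Lp.coeFn_sub (ofBdd 𝔓 (f n.down) (hf n.down) m (hfm n.down)) (ofBdd 𝔓 g hg m hgm)]
      with ω h1 h2 h3 h4 h5
    rw [h4, h1, h5, Pi.sub_apply, h2, h3]
    exact hle _ ω

/-- Every element of `L^∞_c` of norm at most `m` has a representative that is bounded by `m`. -/
theorem exists_ofBdd_eq (X : Linf 𝔓) {m : ℝ} (hm : ‖X‖ ≤ m) :
    ∃ (f : Ω → ℝ) (hf : Measurable f) (h : ∀ ω, |f ω| ≤ m), ofBdd 𝔓 f hf m h = X := by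
  have hm0 : 0 ≤ m := (norm_nonneg X).trans hm
  refine ⟨fun ω => max (-m) (min m (X ω)),
    measurable_const.max (measurable_const.min X.measurable), fun ω => ?_, ?_⟩
  · rw [abs_le]
    exact ⟨le_max_left _ _, max_le (by linarith) (min_le_left _ _)⟩
  · refine Linf.ext_ae ((coeFn_ofBdd _ _).trans ?_)
    filter_upwards [ae_norm_le X] with ω h
    have := abs_le.1 (h.trans hm)
    rw [min_eq_right this.2, max_eq_right this.1]

theorem Linf.memLp (X : Linf 𝔓) {Q : Measure Ω} [IsFiniteMeasure Q] (hQ : Q ≪ polarMeasure 𝔓)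
    (p : ℝ≥0∞) : MemLp X p Q :=
  MemLp.of_bound X.measurable.aestronglyMeasurable ‖X‖ (hQ.ae_le (ae_norm_le X))

theorem integrable_of_L2 {Q : Measure Ω} [IsFiniteMeasure Q] (g : Lp ℝ 2 Q) : Integrable g Q :=
  (Lp.memLp g).integrable one_le_two

theorem inner_toLp_eq_pairing {Q : Measure Ω} [IsFiniteMeasure Q] (hQ : Q ≪ polarMeasure 𝔓)
    (g : Lp ℝ 2 Q) (X : Linf 𝔓) {h : Lp ℝ 2 Q} (hX : h =ᵐ[Q] X) :
    inner ℝ g h = pairing 𝔓 X (densCa Q hQ g) := by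
  rw [pairing_densCa hQ X (integrable_of_L2 g), L2.inner_def]
  refine integral_congr_ae ?_
  filter_upwards [hX] with ω hω
  rw [hω]
  simp [mul_comm]

/-- A point in the weak closure of a convex set is, under each `Q`, the almost sure limit of a
sequence in that set. -/
theorem exists_seq_tendsto_ae {K : Set (Linf 𝔓)} (hK : Convex ℝ K) {X : Linf 𝔓}
    (hX : ∀ (μ : ca 𝔓) (c : ℝ), (∀ Z ∈ K, c ≤ pairing 𝔓 Z μ) → c ≤ pairing 𝔓 X μ)
    {Q : Measure Ω} [IsFiniteMeasure Q] (hQ : Q ≪ polarMeasure 𝔓) :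
    ∃ Z : ℕ → Linf 𝔓, (∀ n, Z n ∈ K) ∧
      ∀ᵐ ω ∂Q, Tendsto (fun n => Z n ω) atTop (nhds (X ω)) := by
  let K₂ : Set (Lp ℝ 2 Q) := {h | ∃ Z ∈ K, h =ᵐ[Q] Z}
  have hconv : Convex ℝ K₂ := by
    rintro h₁ ⟨Z₁, hZ₁, e₁⟩ h₂ ⟨Z₂, hZ₂, e₂⟩ a b ha hb hab
    refine ⟨a • Z₁ + b • Z₂, hK hZ₁ hZ₂ ha hb hab, ?_⟩
    filter_upwards [e₁, e₂, Lp.coeFn_add (a • h₁) (b • h₂), Lp.coeFn_smul a h₁, Lp.coeFn_smul b h₂,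
      hQ.ae_le (Lp.coeFn_add (a • Z₁) (b • Z₂)), hQ.ae_le (Lp.coeFn_smul a Z₁),
      hQ.ae_le (Lp.coeFn_smul b Z₂)] with ω h1 h2 h3 h4 h5 h6 h7 h8
    rw [h3, h6, Pi.add_apply, Pi.add_apply, h4, h5, h7, h8, Pi.smul_apply, Pi.smul_apply,
      Pi.smul_apply, Pi.smul_apply, h1, h2]
  let X₂ : Lp ℝ 2 Q := (X.memLp hQ 2).toLp X
  have hX₂ : X₂ =ᵐ[Q] X := MemLp.coeFn_toLp _
  -- A norm-closed convex set in `L²(Q)` is an intersection of half-spaces, and each `L²` functional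
  -- is the pairing with a measure of density `g` in `ca_c`, so `hX` applies.
  have hmem : X₂ ∈ closure K₂ := by
    by_contra hcon
    obtain ⟨f, c, hfX, hfK⟩ := geometric_hahn_banach_point_closed hconv.closure isClosed_closure hcon
    let g : Lp ℝ 2 Q := (InnerProductSpace.toDual ℝ (Lp ℝ 2 Q)).symm f
    have hg : ∀ h, inner ℝ g h = f h := fun h => InnerProductSpace.toDual_symm_apply
    have h1 := hX (densCa Q hQ g) c fun Z hZ => by
      have hZ₂ : (Z.memLp hQ 2).toLp Z =ᵐ[Q] Z := MemLp.coeFn_toLp _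
      rw [← inner_toLp_eq_pairing hQ g Z hZ₂, hg]
      exact (hfK _ (subset_closure ⟨Z, hZ, hZ₂⟩)).le
    rw [← inner_toLp_eq_pairing hQ g X hX₂, hg] at h1
    exact absurd hfX (not_lt.2 h1)
  obtain ⟨h, hhK, hlim⟩ := mem_closure_iff_seq_limit.1 hmem
  choose Z hZK hZ using hhK
  obtain ⟨ns, -, hns⟩ := (tendstoInMeasure_of_tendsto_Lp hlim).exists_seq_tendsto_ae
  refine ⟨fun n => Z (ns n), fun n => hZK _, ?_⟩
  filter_upwards [hns, ae_all_iff.2 hZ, hX₂] with ω h1 h2 h3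
  simpa only [h2, h3] using h1

/-- Replacing `f` by the constant `-m` off the set `S`. -/
def cutOff (S : Set Ω) (m : ℝ) (f : Ω → ℝ) : Ω → ℝ :=
  open Classical in S.piecewise f fun _ => -m

theorem measurable_cutOff {S : Set Ω} (hS : MeasurableSet S) (m : ℝ) {f : Ω → ℝ}
    (hf : Measurable f) : Measurable (cutOff S m f) :=
  hf.piecewise hS measurable_const

omit [MeasurableSpace Ω] in
theorem abs_cutOff_le (S : Set Ω) {m : ℝ} {f : Ω → ℝ} (h : ∀ ω, |f ω| ≤ m) (ω : Ω) :
    |cutOff S m f ω| ≤ m := by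
  by_cases hω : ω ∈ S
  · simpa [cutOff, hω] using h ω
  · have h0 : 0 ≤ m := (abs_nonneg _).trans (h ω)
    simp [cutOff, hω, abs_of_nonneg h0]

omit [MeasurableSpace Ω] in
theorem cutOff_le (S : Set Ω) {m : ℝ} {f : Ω → ℝ} (h : ∀ ω, |f ω| ≤ m) (ω : Ω) :
    cutOff S m f ω ≤ f ω := by
  by_cases hω : ω ∈ S
  · simp [cutOff, hω]
  · simpa [cutOff, hω] using (abs_le.1 (h ω)).1

theorem ofBdd_mono {f g : Ω → ℝ} (hf : Measurable f) (hg : Measurable g) {a b : ℝ}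
    (hfa : ∀ ω, |f ω| ≤ a) (hgb : ∀ ω, |g ω| ≤ b) (h : ∀ ω, f ω ≤ g ω) :
    ofBdd 𝔓 f hf a hfa ≤ ofBdd 𝔓 g hg b hgb := by
  rw [Linf.le_iff]
  filter_upwards [coeFn_ofBdd (𝔓 := 𝔓) hf hfa, coeFn_ofBdd (𝔓 := 𝔓) hg hgb] with ω h1 h2
  rw [h1, h2]
  exact h ω

/-- The probability measures dominated by `𝔓`, preordered by absolute continuity. -/
def AcIndex (𝔓 : Set (ProbabilityMeasure Ω)) : Type u :=
  {Q : ProbabilityMeasure Ω // (Q : Measure Ω) ≪ polarMeasure 𝔓}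

instance : Preorder (AcIndex 𝔓) where
  le Q R := (Q.1 : Measure Ω) ≪ (R.1 : Measure Ω)
  le_refl _ := Measure.AbsolutelyContinuous.rfl
  le_trans _ _ _ := Measure.AbsolutelyContinuous.trans

theorem exists_probabilityMeasure_ac (Q R : ProbabilityMeasure Ω) :
    ∃ T : ProbabilityMeasure Ω, (Q : Measure Ω) ≪ (T : Measure Ω) ∧ (R : Measure Ω) ≪ (T : Measure Ω) ∧
      (T : Measure Ω) ≪ (Q : Measure Ω) + (R : Measure Ω) := by
  have hc : (2 : ℝ≥0∞)⁻¹ ≠ 0 := by simp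
  refine ⟨⟨(2 : ℝ≥0∞)⁻¹ • ((Q : Measure Ω) + (R : Measure Ω)), ⟨?_⟩⟩, ?_, ?_, ?_⟩
  · rw [Measure.smul_apply, Measure.add_apply, measure_univ, measure_univ, smul_eq_mul,
      one_add_one_eq_two]
    exact ENNReal.inv_mul_cancel (by simp) (by simp)
  · exact (Measure.le_add_right le_rfl).absolutelyContinuous.trans
      (Measure.absolutelyContinuous_smul hc)
  · exact (Measure.le_add_left le_rfl).absolutelyContinuous.trans
      (Measure.absolutelyContinuous_smul hc)
  · exact Measure.smul_absolutelyContinuous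

instance : IsDirectedOrder (AcIndex 𝔓) := ⟨fun Q R => by
  obtain ⟨T, h1, h2, h3⟩ := exists_probabilityMeasure_ac Q.1 R.1
  exact ⟨⟨T, h3.trans (Q.2.add_left R.2)⟩, h1, h2⟩⟩

/-- The level sets of a risk measure with the Fatou property are stable under bounded weak limits. -/
theorem level_mem_of_weak_closure (h𝔓 : 𝔓.Nonempty)
    (hDC : IsDedekindComplete (Linf 𝔓))
    (hoc : ∀ Q : ProbabilityMeasure Ω, (Q : Measure Ω) ≪ polarMeasure 𝔓 →
      OrderContinuous 𝔓 (Q : Measure Ω))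
    {ρ : Linf 𝔓 → ℝ} (hρ : IsConvexRiskMeasure 𝔓 ρ) (hF : HasFatouProperty 𝔓 ρ)
    (X₀ : Linf 𝔓) (c m : ℝ) {X : Linf 𝔓} (hXm : ‖X‖ ≤ m)
    (hX : ∀ (μ : ca 𝔓) (b : ℝ),
      (∀ Z : Linf 𝔓, ρ (Z + X₀) ≤ c → ‖Z‖ ≤ m → b ≤ pairing 𝔓 Z μ) → b ≤ pairing 𝔓 X μ) :
    ρ (X + X₀) ≤ c := by
  classical
  obtain ⟨f, hf, hfm, rfl⟩ := exists_ofBdd_eq X hXm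
  have hm0 : 0 ≤ m := (norm_nonneg _).trans hXm
  have hK : Convex ℝ {Z : Linf 𝔓 | ρ (Z + X₀) ≤ c ∧ ‖Z‖ ≤ m} := by
    rintro Y ⟨hY, hYm⟩ Z ⟨hZ, hZm⟩ a b ha hb hab
    constructor
    · have := hρ.convex.2 (mem_univ (Y + X₀)) (mem_univ (Z + X₀)) ha hb hab
      have he : a • (Y + X₀) + b • (Z + X₀) = a • Y + b • Z + X₀ := by
        rw [smul_add, smul_add, add_add_add_comm, ← add_smul, hab, one_smul]
      rw [he] at this
      refine this.trans ?_
      calc a • ρ (Y + X₀) + b • ρ (Z + X₀) ≤ a * c + b * c := by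
            simp only [smul_eq_mul]; gcongr
        _ = c := by rw [← add_mul, hab, one_mul]
    · have := (convex_closedBall (0 : Linf 𝔓) m) (mem_closedBall_zero_iff.2 hYm)
        (mem_closedBall_zero_iff.2 hZm) ha hb hab
      exact mem_closedBall_zero_iff.1 this
  choose S hSm hSQ hSpolar using fun Q : AcIndex 𝔓 => exists_support hDC Q.2 (hoc Q.1 Q.2)
  -- Off `S Q` all functions become the constant `-m`, while on `S Q` convergence holds up to a
  -- `Q`-null, hence polar, event; so convergence is quasi sure. As `-m` is a lower bound, the cut
  -- lowers the approximants and monotonicity keeps them in the level set.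
  have hcut : ∀ Q : AcIndex 𝔓, ρ (ofBdd 𝔓 (cutOff (S Q) m f) (measurable_cutOff (hSm Q) m hf) m
      (abs_cutOff_le (S Q) hfm) + X₀) ≤ c := by
    intro Q
    obtain ⟨Z, hZK, hZ⟩ := exists_seq_tendsto_ae hK
      (fun μ b h => hX μ b fun Z h1 h2 => h Z ⟨h1, h2⟩) Q.2
    choose z hzm hzb hz using fun n => exists_ofBdd_eq (Z n) (hZK n).2
    have hzlim : ∀ᵐ ω ∂(Q.1 : Measure Ω), Tendsto (fun n => z n ω) atTop (nhds (f ω)) := by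
      have h1 : ∀ n, ∀ᵐ ω ∂(Q.1 : Measure Ω), Z n ω = z n ω := fun n => by
        have := coeFn_ofBdd (𝔓 := 𝔓) (hzm n) (hzb n)
        rw [hz n] at this
        exact Q.2.ae_le this
      filter_upwards [hZ, ae_all_iff.2 h1, Q.2.ae_le (coeFn_ofBdd (𝔓 := 𝔓) hf hfm)] with ω h2 h3 h4
      simpa only [h3, h4] using h2
    have hqs : ∀ᵐ ω ∂polarMeasure 𝔓,
        Tendsto (fun n => cutOff (S Q) m (z n) ω) atTop (nhds (cutOff (S Q) m f ω)) := by
      let A : Set Ω := S Q ∩ {ω | Tendsto (fun n => z n ω) atTop (nhds (f ω))}ᶜ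
      have hTm : MeasurableSet {ω | Tendsto (fun n => z n ω) atTop (nhds (f ω))} :=
        measurableSet_tendsto_fun hzm hf
      have hA := hSpolar Q A ((hSm Q).inter hTm.compl) inter_subset_left
        (measure_mono_null inter_subset_right (mem_ae_iff.1 hzlim))
      filter_upwards [measure_eq_zero_iff_ae_notMem.1 hA] with ω hω
      by_cases h : ω ∈ S Q
      · simp only [cutOff, piecewise_eq_of_mem _ _ _ h]
        by_contra hcon
        exact hω ⟨h, hcon⟩
      · simp only [cutOff, piecewise_eq_of_notMem _ _ _ h]
        exact tendsto_const_nhds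
    have hconv := orderConverges_of_ae_tendsto (fun n => measurable_cutOff (hSm Q) m (hzm n))
      (measurable_cutOff (hSm Q) m hf) (fun n => abs_cutOff_le (S Q) (hzb n))
      (abs_cutOff_le (S Q) hfm) hqs
    refine hF.le_of_orderConverges (hconv.add_right X₀) fun n => ?_
    refine le_trans (hρ.monotone ?_) (hZK n.down).1
    rw [← hz n.down]
    exact add_le_add_left (ofBdd_mono _ _ _ _ (cutOff_le (S Q) (hzb n.down))) X₀
  have : Nonempty (AcIndex 𝔓) := by
    obtain ⟨P, hP⟩ := h𝔓
    exact ⟨⟨P, absolutelyContinuous_polarMeasure hP⟩⟩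
  -- Second limit: along the directed family of `Q`, the cut-offs converge in order to `f` with
  -- error at most `2m` off `S Q`.
  refine hF.le_of_orderConverges (OrderConverges.add_right (Y := ofBdd 𝔓 f hf m hfm) ?_ X₀) hcut
  have hyb : ∀ (Q : AcIndex 𝔓) ω, |(S Q)ᶜ.indicator (fun _ => 2 * m) ω| ≤ 2 * m := fun Q ω => by
    by_cases h : ω ∈ S Q <;> simp [h, abs_of_nonneg hm0, hm0]
  have hym : ∀ Q : AcIndex 𝔓, Measurable ((S Q)ᶜ.indicator fun _ => 2 * m) := fun Q =>
    measurable_const.indicator (hSm Q).compl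
  refine ⟨fun Q => ofBdd 𝔓 _ (hym Q) (2 * m) (hyb Q), ?_, ⟨?_, ?_⟩, ?_⟩
  · intro Q R hQR
    -- For `Q ≪ R`, the part of `S Q` outside `S R` is `R`-null, hence `Q`-null, hence polar:
    -- supports grow with `Q`.
    have hA := hSpolar Q (S Q ∩ (S R)ᶜ) ((hSm Q).inter (hSm R).compl) inter_subset_left
      (measure_mono_null inter_subset_right (hQR (hSQ R)))
    rw [Linf.le_iff]
    filter_upwards [coeFn_ofBdd (𝔓 := 𝔓) (hym Q) (hyb Q), coeFn_ofBdd (𝔓 := 𝔓) (hym R) (hyb R),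
      measure_eq_zero_iff_ae_notMem.1 hA] with ω h1 h2 h3
    rw [h1, h2]
    by_cases hQ : ω ∈ S Q
    · have hR : ω ∈ S R := by
        by_contra hR
        exact h3 ⟨hQ, hR⟩
      simp [hQ, hR]
    · by_cases hR : ω ∈ S R <;> simp [hQ, hR, hm0]
  · rintro _ ⟨Q, rfl⟩
    rw [Linf.le_iff]
    filter_upwards [coeFn_ofBdd (𝔓 := 𝔓) (hym Q) (hyb Q), Lp.coeFn_zero ℝ ∞ (polarMeasure 𝔓)]
      with ω h1 h2
    rw [h1, h2]
    exact indicator_nonneg (fun _ _ => by positivity) ω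
  · intro W hW
    have h0 : W ≤ constLinf 𝔓 0 := by
      rw [Linf.le_constLinf_iff, ae_polarMeasure_iff (measurableSet_le W.measurable measurable_const)]
      intro P hP
      -- Each `P ∈ 𝔓` is itself an index whose error vanishes `P`-almost surely, so any lower bound
      -- is nonpositive quasi surely.
      let Q : AcIndex 𝔓 := ⟨P, absolutelyContinuous_polarMeasure hP⟩
      have hS : ∀ᵐ ω ∂(P : Measure Ω), ω ∈ S Q := mem_ae_iff.2 (hSQ Q)
      filter_upwards [Q.2.ae_le (Linf.le_iff.1 (hW ⟨Q, rfl⟩)),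
        Q.2.ae_le (coeFn_ofBdd (𝔓 := 𝔓) (hym Q) (hyb Q)), hS] with ω h1 h2 h3
      rw [h2] at h1
      simpa [h3] using h1
    rw [Linf.le_constLinf_iff] at h0
    rw [Linf.le_iff]
    filter_upwards [h0, Lp.coeFn_zero ℝ ∞ (polarMeasure 𝔓)] with ω h1 h2
    rwa [h2]
  · intro Q
    rw [Linf.le_iff]
    have hcb := abs_cutOff_le (S Q) hfm
    have hcm := measurable_cutOff (hSm Q) m hf
    filter_upwards [coeFn_ofBdd (𝔓 := 𝔓) (hym Q) (hyb Q), coeFn_ofBdd (𝔓 := 𝔓) hf hfm,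
      coeFn_ofBdd (𝔓 := 𝔓) hcm hcb,
      Lp.coeFn_abs (ofBdd 𝔓 _ hcm m hcb - ofBdd 𝔓 f hf m hfm),
      Lp.coeFn_sub (ofBdd 𝔓 _ hcm m hcb) (ofBdd 𝔓 f hf m hfm)] with ω h1 h2 h3 h4 h5
    rw [h1, h4, h5, Pi.sub_apply, h2, h3]
    by_cases h : ω ∈ S Q
    · simp [h, cutOff]
    · rw [indicator_of_mem h]
      exact (abs_sub _ _).trans (by linarith [hcb ω, hfm ω])

/-! ### Separation by probability measures and the robust representation -/

/-- The indicator of an event as an element of `L^∞_c`. -/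
def indLinf (𝔓 : Set (ProbabilityMeasure Ω)) {A : Set Ω} (hA : MeasurableSet A) : Linf 𝔓 :=
  ofBdd 𝔓 (A.indicator fun _ => 1) (measurable_const.indicator hA) 1 fun ω => by
    by_cases h : ω ∈ A <;> simp [h]

theorem coeFn_indLinf {A : Set Ω} (hA : MeasurableSet A) :
    indLinf 𝔓 hA =ᵐ[polarMeasure 𝔓] A.indicator fun _ => 1 := coeFn_ofBdd _ _

theorem indLinf_nonneg {A : Set Ω} (hA : MeasurableSet A) : 0 ≤ indLinf 𝔓 hA := by
  rw [Linf.le_iff]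
  filter_upwards [coeFn_indLinf (𝔓 := 𝔓) hA, Lp.coeFn_zero ℝ ∞ (polarMeasure 𝔓)] with ω h1 h2
  rw [h1, h2]
  exact indicator_nonneg (fun _ _ => zero_le_one) ω

theorem integral_indLinf {A : Set Ω} (hA : MeasurableSet A) {μ : Measure Ω}
    (h : μ ≪ polarMeasure 𝔓) : ∫ ω, indLinf 𝔓 hA ω ∂μ = μ.real A := by
  rw [integral_congr_ae (h.ae_le (coeFn_indLinf hA)), integral_indicator hA]
  simp

theorem pairing_indLinf {A : Set Ω} (hA : MeasurableSet A) (μ : ca 𝔓) :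
    pairing 𝔓 (indLinf 𝔓 hA) μ = (μ : SignedMeasure Ω) A := by
  rw [pairing_apply, signedIntegral, integral_indLinf hA (posPart_ac μ),
    integral_indLinf hA (negPart_ac μ), ← SignedMeasure.apply_eq_posPart_real_sub_negPart_real _ hA]

/-- The negative part is carried by the negative set of a Hahn decomposition, whose mass is both
nonpositive and nonnegative. -/
theorem negPart_eq_zero_of_nonneg {μ : SignedMeasure Ω} (h : ∀ A, MeasurableSet A → 0 ≤ μ A) :
    μ.toJordanDecomposition.negPart = 0 := by
  obtain ⟨i, hi, -, h2, -, hn⟩ := μ.toJordanDecomposition_spec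
  refine Measure.measure_univ_eq_zero.1 ?_
  have h0 : μ iᶜ = 0 := le_antisymm (VectorMeasure.nonpos_of_restrict_le_zero _ h2) (h _ hi.compl)
  rw [hn, SignedMeasure.toMeasureOfLEZero_apply _ _ _ MeasurableSet.univ]
  simp [h0]

/-- A nonzero element of `ca_c` with nonnegative values is a multiple of a probability measure. -/
theorem exists_probabilityMeasure_of_nonneg {μ : ca 𝔓}
    (h : ∀ A, MeasurableSet A → 0 ≤ (μ : SignedMeasure Ω) A) (h0 : μ ≠ 0) :
    ∃ (Q : ProbabilityMeasure Ω) (_ : (Q : Measure Ω) ≪ polarMeasure 𝔓) (r : ℝ), 0 < r ∧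
      ∀ X : Linf 𝔓, ∫ ω, X ω ∂(Q : Measure Ω) = r * pairing 𝔓 X μ := by
  set p := (μ : SignedMeasure Ω).toJordanDecomposition.posPart with hp
  have hpair : ∀ X : Linf 𝔓, pairing 𝔓 X μ = ∫ ω, X ω ∂p := fun X => by
    rw [pairing_apply, signedIntegral, negPart_eq_zero_of_nonneg h, integral_zero_measure, sub_zero]
  have hp0 : p ≠ 0 := by
    intro hp0
    apply h0
    have h1 := norm_ca_def 𝔓 μ
    rw [SignedMeasure.totalVariation, negPart_eq_zero_of_nonneg h, ← hp, hp0] at h1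
    simpa using h1
  have hpu : p univ ≠ 0 := by simpa using hp0
  refine ⟨⟨(p univ)⁻¹ • p, ⟨?_⟩⟩, ?_, (p univ)⁻¹.toReal, ?_, fun X => ?_⟩
  · rw [Measure.smul_apply, smul_eq_mul]
    exact ENNReal.inv_mul_cancel hpu (measure_ne_top _ _)
  · exact Measure.smul_absolutelyContinuous.trans (posPart_ac μ)
  · exact ENNReal.toReal_pos (ENNReal.inv_ne_zero.2 (measure_ne_top _ _)) (ENNReal.inv_ne_top.2 hpu)
  · rw [hpair X]
    exact integral_smul_measure _ _

/-- Separation of a point from a level set of a risk measure by a dominated probability measure. -/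
theorem exists_probabilityMeasure_integral_sub_le (h𝔓 : 𝔓.Nonempty)
    (hDC : IsDedekindComplete (Linf 𝔓)) (hdual : DualOfCaIsLinf 𝔓)
    {ρ : Linf 𝔓 → ℝ} (hρ : IsConvexRiskMeasure 𝔓 ρ) (hF : HasFatouProperty 𝔓 ρ)
    (X₀ : Linf 𝔓) {ε : ℝ} (hε : 0 < ε) :
    ∃ (Q : ProbabilityMeasure Ω), (Q : Measure Ω) ≪ polarMeasure 𝔓 ∧
      ∀ X : Linf 𝔓, ∫ ω, X ω ∂(Q : Measure Ω) - ρ X ≤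
        ∫ ω, X₀ ω ∂(Q : Measure Ω) - ρ X₀ + ε := by
  have hoc : ∀ Q : ProbabilityMeasure Ω, (Q : Measure Ω) ≪ polarMeasure 𝔓 →
      OrderContinuous 𝔓 (Q : Measure Ω) := fun Q hQ => orderContinuous_of_dual hdual _ hQ
  obtain ⟨e, he⟩ := hdual
  have he' : ∀ X, e X = pairing 𝔓 X := fun X => by ext μ; exact he X μ
  -- The Lipschitz bound gives `ε ≤ δ ‖φ‖` on the level set, so `δ = ε / 2` makes the inequality `1
  -- < ‖φ‖` strict.
  obtain ⟨δ, hδ, hδε⟩ : ∃ δ : ℝ, 0 < δ ∧ δ = ε / 2 := ⟨ε / 2, by linarith, rfl⟩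
  -- scaled so that the level set misses the closed unit ball
  let C : Set (StrongDual ℝ (ca 𝔓)) := {φ | ρ (δ • e.symm φ + X₀) ≤ ρ X₀ - ε}
  have hCmem : ∀ Z : Linf 𝔓, pairing 𝔓 Z ∈ C ↔ ρ (δ • Z + X₀) ≤ ρ X₀ - ε := fun Z => by
    rw [← he']
    change ρ (δ • e.symm (e Z) + X₀) ≤ _ ↔ _
    rw [e.symm_apply_apply]
  have hconv : Convex ℝ C := by
    intro φ hφ ψ hψ a b ha hb hab
    have := hρ.convex.2 (mem_univ (δ • e.symm φ + X₀)) (mem_univ (δ • e.symm ψ + X₀)) ha hb hab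
    have he : a • (δ • e.symm φ + X₀) + b • (δ • e.symm ψ + X₀) =
        δ • e.symm (a • φ + b • ψ) + X₀ := by
      rw [map_add, map_smul, map_smul, smul_add, smul_add, smul_add, add_add_add_comm, ← add_smul,
        hab, one_smul, smul_comm a δ, smul_comm b δ]
    rw [he] at this
    refine this.trans ?_
    calc a • ρ (δ • e.symm φ + X₀) + b • ρ (δ • e.symm ψ + X₀)
        ≤ a * (ρ X₀ - ε) + b * (ρ X₀ - ε) := by
          simp only [smul_eq_mul]
          exact add_le_add (mul_le_mul_of_nonneg_left hφ ha) (mul_le_mul_of_nonneg_left hψ hb)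
      _ = ρ X₀ - ε := by rw [← add_mul, hab, one_mul]
  have hnorm : ∀ φ ∈ C, 1 < ‖φ‖ := by
    intro φ hφ
    have h1 := hρ.sub_le_norm X₀ (δ • e.symm φ + X₀)
    rw [sub_add_cancel_right, norm_neg, norm_smul, e.symm.norm_map, Real.norm_of_nonneg hδ.le] at h1
    have h2 : ρ (δ • e.symm φ + X₀) ≤ ρ X₀ - ε := hφ
    by_contra hcon
    have := mul_le_mul_of_nonneg_left (not_lt.1 hcon) hδ.le
    linarith
  have hclosed : ∀ n : ℕ, IsClosed
      (WeakDual.toStrongDual ⁻¹' (C ∩ Metric.closedBall 0 n) : Set (WeakDual ℝ (ca 𝔓))) := by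
    intro n
    refine isClosed_of_closure_subset fun φ hφ => ?_
    have hball : WeakDual.toStrongDual φ ∈ Metric.closedBall (0 : StrongDual ℝ (ca 𝔓)) n := by
      have := closure_mono (t := WeakDual.toStrongDual ⁻¹' Metric.closedBall 0 (n : ℝ))
        (fun ψ hψ => hψ.2) hφ
      rwa [(WeakDual.isClosed_closedBall 0 (n : ℝ)).closure_eq] at this
    refine ⟨?_, hball⟩
    have hn : ‖δ • e.symm (WeakDual.toStrongDual φ)‖ ≤ δ * n := by
      rw [norm_smul, e.symm.norm_map, Real.norm_of_nonneg hδ.le]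
      exact mul_le_mul_of_nonneg_left (mem_closedBall_zero_iff.1 hball) hδ.le
    refine level_mem_of_weak_closure h𝔓 hDC hoc hρ hF X₀ (ρ X₀ - ε) (δ * n) hn fun μ b hb => ?_
    -- A half-space given by `μ ∈ ca_c` is weak-* closed, so it contains `φ` as soon as it contains
    -- the bounded part of `C`.
    have hsub : WeakDual.toStrongDual ⁻¹' (C ∩ Metric.closedBall 0 (n : ℝ)) ⊆
        {ψ : WeakDual ℝ (ca 𝔓) | b ≤ δ * ψ μ} := by
      rintro ψ ⟨hψC, hψn⟩
      have := hb (δ • e.symm (WeakDual.toStrongDual ψ)) hψC (by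
        rw [norm_smul, e.symm.norm_map, Real.norm_of_nonneg hδ.le]
        exact mul_le_mul_of_nonneg_left (mem_closedBall_zero_iff.1 hψn) hδ.le)
      rw [← he', map_smul, e.apply_symm_apply] at this
      exact this
    have hcl : IsClosed {ψ : WeakDual ℝ (ca 𝔓) | b ≤ δ * ψ μ} :=
      isClosed_le continuous_const (continuous_const.mul (WeakDual.eval_continuous μ))
    have := closure_minimal hsub hcl hφ
    rw [← he', map_smul, e.apply_symm_apply]
    exact this
  obtain ⟨μ, hμ⟩ := exists_one_le_of_isClosed_inter_closedBall hconv hclosed hnorm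
  -- `C` is downward closed, so `-μ` is positive
  have hshift : ∀ X : Linf 𝔓, ∃ t : ℝ, ρ (X + constLinf 𝔓 t) ≤ ρ X₀ - ε := fun X =>
    ⟨ρ X₀ - ε - ρ X, by rw [hρ.cash_additive]; linarith⟩
  have hμ' : ∀ Z : Linf 𝔓, ρ (Z + X₀) ≤ ρ X₀ - ε → δ ≤ pairing 𝔓 Z μ := by
    intro Z hZ
    have h1 := hμ _ ((hCmem (δ⁻¹ • Z)).2 (by rwa [smul_inv_smul₀ hδ.ne']))
    rw [map_smul, smul_apply, smul_eq_mul, ← div_eq_inv_mul,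
      le_div_iff₀ hδ, one_mul] at h1
    exact h1
  obtain ⟨t, ht⟩ := hshift X₀
  have hZ₁ : ρ (constLinf 𝔓 t + X₀) ≤ ρ X₀ - ε := by rwa [add_comm]
  have hneg : ∀ A, MeasurableSet A → 0 ≤ ((-μ : ca 𝔓) : SignedMeasure Ω) A := by
    intro A hA
    by_contra hcon
    have hpos : 0 < (μ : SignedMeasure Ω) A := by
      have : ((-μ : ca 𝔓) : SignedMeasure Ω) A = -((μ : SignedMeasure Ω) A) := rfl
      rw [this] at hcon
      linarith
    -- If `μ A > 0`, subtracting a large multiple of `1_A` stays in the level set but makes the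
    -- pairing with `μ` negative.
    obtain ⟨s, hs⟩ := exists_nat_gt (pairing 𝔓 (constLinf 𝔓 t) μ / (μ : SignedMeasure Ω) A)
    have h1 := hμ' (constLinf 𝔓 t - s • indLinf 𝔓 hA) (le_trans (hρ.monotone (by
      gcongr
      rw [sub_le_self_iff]
      exact nsmul_nonneg (indLinf_nonneg hA) s)) hZ₁)
    rw [map_sub, map_nsmul, sub_apply, smul_apply, pairing_indLinf, nsmul_eq_mul] at h1
    rw [div_lt_iff₀ hpos] at hs
    linarith
  have hμ0 : -μ ≠ 0 := by
    intro h
    have := hμ' _ hZ₁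
    rw [neg_eq_zero.1 h, map_zero] at this
    linarith
  obtain ⟨Q, hQ, r, hr, hQr⟩ := exists_probabilityMeasure_of_nonneg hneg hμ0
  refine ⟨Q, hQ, fun X => ?_⟩
  -- The cash amount that moves `X` exactly onto the level `ρ X₀ - ε`.
  let k : ℝ := ρ X₀ - ε - ρ X
  have h1 := hμ' (X + constLinf 𝔓 k - X₀) (by
    rw [sub_add_cancel, hρ.cash_additive]; simp [k])
  have h2 := hQr (X + constLinf 𝔓 k - X₀)
  rw [map_neg, Linf.integral_sub _ _ hQ, Linf.integral_add _ _ hQ,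
    integral_congr_ae (hQ.ae_le (coeFn_constLinf k)), integral_const, probReal_univ, one_smul] at h2
  have h3 : r * -(pairing 𝔓 (X + constLinf 𝔓 k - X₀) μ) ≤ 0 :=
    mul_nonpos_of_nonneg_of_nonpos hr.le (by linarith)
  simp only [k] at h2
  linarith

/-- The penalty is the convex conjugate of `ρ`, so one inequality is immediate. The approximate
subgradients at `X` give the other, and the one at `0` shows that the penalty is somewhere finite.
-/
theorem hasRobustRepresentation_of_hasFatouProperty (h𝔓 : 𝔓.Nonempty)
    (hDC : IsDedekindComplete (Linf 𝔓)) (hdual : DualOfCaIsLinf 𝔓)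
    {ρ : Linf 𝔓 → ℝ} (hρ : IsConvexRiskMeasure 𝔓 ρ) (hF : HasFatouProperty 𝔓 ρ) :
    HasRobustRepresentation 𝔓 ρ := by
  let α : DominatedProb 𝔓 → EReal := fun Q =>
    ⨆ X : Linf 𝔓, ((∫ ω, X ω ∂(Q.1 : Measure Ω) - ρ X : ℝ) : EReal)
  have hle : ∀ (Q : DominatedProb 𝔓) (X : Linf 𝔓),
      ((∫ ω, X ω ∂(Q.1 : Measure Ω) - ρ X : ℝ) : EReal) ≤ α Q := fun Q X =>
    le_iSup (fun X : Linf 𝔓 => ((∫ ω, X ω ∂(Q.1 : Measure Ω) - ρ X : ℝ) : EReal)) X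
  have hex : ∀ (X₀ : Linf 𝔓) {ε : ℝ}, 0 < ε → ∃ Q : DominatedProb 𝔓,
      α Q ≤ ((∫ ω, X₀ ω ∂(Q.1 : Measure Ω) - ρ X₀ + ε : ℝ) : EReal) := by
    intro X₀ ε hε
    obtain ⟨Q, hQ, h⟩ := exists_probabilityMeasure_integral_sub_le h𝔓 hDC hdual hρ hF X₀ hε
    exact ⟨⟨Q, dominatedBy_iff.2 hQ⟩, iSup_le fun X => EReal.coe_le_coe_iff.2 (h X)⟩
  refine ⟨α, ⟨-ρ 0, fun Q => ?_⟩, ?_, fun X => le_antisymm ?_ (iSup_le fun Q => ?_)⟩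
  · refine le_trans ?_ (hle Q 0)
    rw [EReal.coe_le_coe_iff, integral_congr_ae ((dominatedBy_iff.1 Q.2).ae_le (Lp.coeFn_zero ..))]
    simp
  · obtain ⟨Q, hQ⟩ := hex 0 one_pos
    exact ⟨Q, ne_top_of_le_ne_top (EReal.coe_ne_top _) hQ⟩
  · refine EReal.le_of_forall_lt_iff_le.1 fun c hc => ?_
    by_contra hcon
    rw [EReal.coe_le_coe_iff, not_le] at hcon
    -- With error `ρ X - c`, the penalised expectation under `Q` is at least `c`, contradicting
    -- `hc`.
    obtain ⟨Q, hQ⟩ := hex X (sub_pos.2 hcon)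
    refine absurd (lt_of_le_of_lt (le_iSup _ Q) hc) (not_lt.2 ?_)
    induction hαQ : α Q with
    | bot => exact absurd (le_bot_iff.1 (hαQ ▸ hle Q 0)) (EReal.coe_ne_bot _)
    | top => exact absurd (top_le_iff.1 (hαQ ▸ hQ)) (EReal.coe_ne_top _)
    | coe a =>
      rw [hαQ, EReal.coe_le_coe_iff] at hQ
      rw [← EReal.coe_sub, EReal.coe_le_coe_iff]
      linarith
  · induction hαQ : α Q with
    | bot => exact absurd (le_bot_iff.1 (hαQ ▸ hle Q 0)) (EReal.coe_ne_bot _)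
    | top => simp
    | coe a =>
      have := hle Q X
      rw [hαQ, EReal.coe_le_coe_iff] at this
      rw [← EReal.coe_sub, EReal.coe_le_coe_iff]
      linarith

/-! ### Functionals on `ca_c`: local densities and gluing -/

/-- Under a probability measure the `L¹` norm is at most the `L²` norm, so `φ` is bounded on `L²`
densities and Riesz representation applies. -/
theorem exists_L2_inner_eq {Q : Measure Ω} [IsProbabilityMeasure Q] (hQ : Q ≪ polarMeasure 𝔓)
    (φ : StrongDual ℝ (ca 𝔓)) :
    ∃ g : Lp ℝ 2 Q, ∀ h : Lp ℝ 2 Q, inner ℝ g h = φ (densCa Q hQ h) := by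
  let L : Lp ℝ 2 Q →ₗ[ℝ] ℝ :=
    { toFun := fun h => φ (densCa Q hQ h)
      map_add' := fun h k => by
        rw [densCa_congr hQ (Lp.coeFn_add h k),
          densCa_add hQ (integrable_of_L2 h) (integrable_of_L2 k), map_add]
      map_smul' := fun c h => by
        rw [densCa_congr hQ (Lp.coeFn_smul c h), densCa_smul, map_smul]; rfl }
  have hL : ∀ h, ‖L h‖ ≤ ‖φ‖ * ‖h‖ := fun h => by
    refine (φ.le_opNorm _).trans (mul_le_mul_of_nonneg_left ?_ (norm_nonneg φ))
    rw [norm_densCa hQ (integrable_of_L2 h), integral_norm_eq_lintegral_enorm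
      (Lp.aestronglyMeasurable h), ← eLpNorm_one_eq_lintegral_enorm, Lp.norm_def]
    exact ENNReal.toReal_mono (Lp.eLpNorm_ne_top h)
      (eLpNorm_le_eLpNorm_of_exponent_le one_le_two (Lp.aestronglyMeasurable h))
  refine ⟨(InnerProductSpace.toDual ℝ (Lp ℝ 2 Q)).symm (L.mkContinuous ‖φ‖ hL), fun h => ?_⟩
  rw [InnerProductSpace.toDual_symm_apply]
  rfl

/-- Passing from a density to its measure is an isometry of `L¹(Q)` into `ca_c`, and indicators span
a dense subspace of `L¹(Q)`. -/
theorem densCa_eq_zero_of_indicator {Q : Measure Ω} [IsFiniteMeasure Q] (hQ : Q ≪ polarMeasure 𝔓)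
    {ψ : StrongDual ℝ (ca 𝔓)}
    (hψ : ∀ A, MeasurableSet A → ψ (densCa Q hQ (A.indicator fun _ => 1)) = 0)
    {f : Ω → ℝ} (hf : Integrable f Q) : ψ (densCa Q hQ f) = 0 := by
  refine Integrable.induction (fun f => ψ (densCa Q hQ f) = 0) ?_ ?_ ?_ ?_ hf
  · intro c s hs _
    have : (s.indicator fun _ => c) = c • s.indicator fun _ => (1 : ℝ) := by
      ext ω
      by_cases h : ω ∈ s <;> simp [h]
    rw [this, densCa_smul, map_smul, hψ s hs, smul_zero]
  · intro f g _ hf hg h1 h2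
    rw [densCa_add hQ hf hg, map_add, h1, h2, add_zero]
  · have hiso : Isometry fun f : Lp ℝ 1 Q => densCa Q hQ f := by
      refine Isometry.of_dist_eq fun f g => ?_
      rw [dist_eq_norm, dist_eq_norm, ← densCa_sub hQ (L1.integrable_coeFn f)
        (L1.integrable_coeFn g), norm_densCa hQ ((L1.integrable_coeFn f).sub (L1.integrable_coeFn g)),
        L1.norm_eq_integral_norm]
      refine integral_congr_ae ?_
      filter_upwards [Lp.coeFn_sub f g] with ω h
      rw [h]
    exact isClosed_eq (ψ.continuous.comp hiso.continuous) continuous_const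
  · intro f g hfg _ h
    rwa [← densCa_congr hQ hfg]

/-- A bounded functional on `ca_c` is given, on the measures dominated by a fixed probability
measure, by integration of a bounded function. -/
theorem exists_density_of_functional {Q : Measure Ω} [IsProbabilityMeasure Q]
    (hQ : Q ≪ polarMeasure 𝔓) (φ : StrongDual ℝ (ca 𝔓)) :
    ∃ g : Ω → ℝ, Measurable g ∧ (∀ ω, |g ω| ≤ ‖φ‖) ∧
      ∀ (μ : Measure Ω) [IsFiniteMeasure μ] (h : μ ≪ Q), φ (toCa μ (h.trans hQ)) = ∫ ω, g ω ∂μ := by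
  obtain ⟨k, hk⟩ := exists_L2_inner_eq hQ φ
  have hkm : Measurable k := (Lp.stronglyMeasurable k).measurable
  have hkA : ∀ A, MeasurableSet A →
      ∫ ω in A, k ω ∂Q = φ (densCa Q hQ (A.indicator fun _ => 1)) := by
    intro A hA
    rw [← L2.inner_indicatorConstLp_one (𝕜 := ℝ) hA (measure_ne_top Q A), real_inner_comm, hk,
      densCa_congr hQ indicatorConstLp_coeFn]
  have hkA' : ∀ A, MeasurableSet A → |∫ ω in A, k ω ∂Q| ≤ ‖φ‖ * Q.real A := by
    intro A hA
    rw [hkA A hA]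
    refine (φ.le_opNorm _).trans (mul_le_mul_of_nonneg_left ?_ (norm_nonneg φ))
    rw [norm_densCa hQ ((integrable_const 1).indicator hA)]
    simp only [norm_indicator_eq_indicator_norm, norm_one]
    rw [integral_indicator hA]
    simp
  have hk1 : k ≤ᵐ[Q] fun _ => ‖φ‖ :=
    ae_le_of_forall_setIntegral_le (integrable_of_L2 k) (integrable_const _) fun A hA _ => by
      rw [setIntegral_const, smul_eq_mul, mul_comm]
      exact (abs_le.1 (hkA' A hA)).2
  have hk2 : (fun _ => -‖φ‖) ≤ᵐ[Q] k :=
    ae_le_of_forall_setIntegral_le (integrable_const _) (integrable_of_L2 k) fun A hA _ => by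
      rw [setIntegral_const, smul_eq_mul, mul_comm, neg_mul]
      exact (abs_le.1 (hkA' A hA)).1
  -- The bound `|k| ≤ ‖φ‖` holds only `Q`-almost surely; truncation makes it hold everywhere, so
  -- that `g` defines a class in `L^∞_c`.
  let g : Ω → ℝ := fun ω => max (-‖φ‖) (min ‖φ‖ (k ω))
  have hgm : Measurable g := measurable_const.max (measurable_const.min hkm)
  have hgb : ∀ ω, |g ω| ≤ ‖φ‖ := fun ω => abs_le.2
    ⟨le_max_left _ _, max_le (by linarith [norm_nonneg φ]) (min_le_left _ _)⟩
  have hgk : g =ᵐ[Q] k := by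
    filter_upwards [hk1, hk2] with ω h1 h2
    simp only [g]
    rw [min_eq_right h1, max_eq_right h2]
  refine ⟨g, hgm, hgb, fun μ _ h => ?_⟩
  have hG : ofBdd 𝔓 g hgm ‖φ‖ hgb =ᵐ[polarMeasure 𝔓] g := coeFn_ofBdd _ _
  have hψ := densCa_eq_zero_of_indicator hQ (ψ := φ - pairing 𝔓 (ofBdd 𝔓 g hgm ‖φ‖ hgb)) (by
    intro A hA
    rw [sub_apply, pairing_densCa hQ _ ((integrable_const 1).indicator hA), ← hkA A hA, sub_eq_zero,
      ← integral_indicator hA]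
    refine integral_congr_ae ?_
    filter_upwards [hgk, hQ.ae_le hG] with ω h1 h2
    rw [h2, h1]
    by_cases hω : ω ∈ A <;> simp [hω]) (f := fun ω => (μ.rnDeriv Q ω).toReal)
    (Measure.integrable_toReal_rnDeriv)
  rw [← toCa_eq_densCa hQ h, sub_apply, sub_eq_zero, pairing_toCa] at hψ
  rw [hψ]
  exact integral_congr_ae ((h.trans hQ).ae_le hG)

theorem exists_acIndex_ac (h𝔓 : 𝔓.Nonempty) {μ : Measure Ω} [IsFiniteMeasure μ]
    (hμ : μ ≪ polarMeasure 𝔓) : ∃ Q : AcIndex 𝔓, μ ≪ (Q.1 : Measure Ω) := by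
  rcases eq_or_ne μ 0 with rfl | h0
  · obtain ⟨P, hP⟩ := h𝔓
    exact ⟨⟨P, absolutelyContinuous_polarMeasure hP⟩, Measure.AbsolutelyContinuous.zero _⟩
  · have hu : μ univ ≠ 0 := by simpa using h0
    refine ⟨⟨⟨(μ univ)⁻¹ • μ, ⟨?_⟩⟩, Measure.smul_absolutelyContinuous.trans hμ⟩,
      Measure.absolutelyContinuous_smul (ENNReal.inv_ne_zero.2 (measure_ne_top _ _))⟩
    rw [Measure.smul_apply, smul_eq_mul]
    exact ENNReal.inv_mul_cancel hu (measure_ne_top _ _)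

/-- Two bounded functions that represent the same functional on measures dominated by `Q` and by
`R` agree quasi surely where the supports of `Q` and `R` meet. -/
theorem ae_eq_on_inter_support {φ : StrongDual ℝ (ca 𝔓)} {Q R : Measure Ω} {S T : Set Ω}
    (hS : MeasurableSet S) (hT : MeasurableSet T)
    (hSQ : ∀ A, MeasurableSet A → A ⊆ S → Q A = 0 → polarMeasure 𝔓 A = 0)
    (hTR : ∀ A, MeasurableSet A → A ⊆ T → R A = 0 → polarMeasure 𝔓 A = 0)
    (hQ : Q ≪ polarMeasure 𝔓) (hR : R ≪ polarMeasure 𝔓)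
    {f g : Ω → ℝ} (hf : Measurable f) (hg : Measurable g) {m : ℝ} (hfm : ∀ ω, |f ω| ≤ m)
    (hgm : ∀ ω, |g ω| ≤ m)
    (hfQ : ∀ (μ : Measure Ω) [IsFiniteMeasure μ] (h : μ ≪ Q), φ (toCa μ (h.trans hQ)) = ∫ ω, f ω ∂μ)
    (hgR : ∀ (μ : Measure Ω) [IsFiniteMeasure μ] (h : μ ≪ R), φ (toCa μ (h.trans hR)) = ∫ ω, g ω ∂μ) :
    ∀ᵐ ω ∂polarMeasure 𝔓, ω ∈ S ∩ T → f ω = g ω := by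
  rw [ae_polarMeasure_iff]
  swap
  · have : {ω | ω ∈ S ∩ T → f ω = g ω} = (S ∩ T)ᶜ ∪ {ω | f ω = g ω} := by
      ext ω
      exact imp_iff_not_or
    rw [this]
    exact (hS.inter hT).compl.union (measurableSet_eq_fun hf hg)
  intro P hP
  have hPac := absolutelyContinuous_polarMeasure hP
  -- By the support property `ν` is dominated by both `Q` and `R`, so `f` and `g` both represent `φ`
  -- on its restrictions.
  let ν : Measure Ω := (P : Measure Ω).restrict (S ∩ T)
  have hνQ : ν ≪ Q := Measure.AbsolutelyContinuous.mk fun A hA h0 => by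
    rw [Measure.restrict_apply hA]
    refine measure_mono_null (t := A ∩ S) (inter_subset_inter_right _ inter_subset_left) (hPac ?_)
    exact hSQ _ (hA.inter hS) inter_subset_right (measure_mono_null inter_subset_left h0)
  have hνR : ν ≪ R := Measure.AbsolutelyContinuous.mk fun A hA h0 => by
    rw [Measure.restrict_apply hA]
    refine measure_mono_null (t := A ∩ T) (inter_subset_inter_right _ inter_subset_right) (hPac ?_)
    exact hTR _ (hA.inter hT) inter_subset_right (measure_mono_null inter_subset_left h0)
  rw [← ae_restrict_iff' (hS.inter hT)]
  refine Integrable.ae_eq_of_forall_setIntegral_eq f g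
    (Integrable.of_bound hf.aestronglyMeasurable m (.of_forall hfm))
    (Integrable.of_bound hg.aestronglyMeasurable m (.of_forall hgm)) fun A hA _ => ?_
  have hle : ν.restrict A ≪ ν := Measure.restrict_le_self.absolutelyContinuous
  exact (hfQ (ν.restrict A) (hle.trans hνQ)).symm.trans (hgR (ν.restrict A) (hle.trans hνR))

/-- A consistent family of bounded functions can be glued in the Dedekind complete space `L^∞_c`. -/
theorem exists_glue {ι : Type u} [Nonempty ι] (hDC : IsDedekindComplete (Linf 𝔓)) {S : ι → Set Ω}
    (hS : ∀ i, MeasurableSet (S i)) {g : ι → Ω → ℝ} (hg : ∀ i, Measurable (g i)) {m : ℝ}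
    (hgm : ∀ i ω, |g i ω| ≤ m)
    (hcons : ∀ i j, ∀ᵐ ω ∂polarMeasure 𝔓, ω ∈ S i ∩ S j → g i ω = g j ω) :
    ∃ X : Linf 𝔓, ∀ i, ∀ᵐ ω ∂polarMeasure 𝔓, ω ∈ S i → X ω = g i ω := by
  classical
  -- Adding `m` makes the functions nonnegative, so that the value `0` off `S i` cannot push the
  -- supremum above another member of the family.
  have hg0 : ∀ i ω, 0 ≤ g i ω + m := fun i ω => by linarith [(abs_le.1 (hgm i ω)).1]
  have hg2 : ∀ i ω, g i ω + m ≤ 2 * m := fun i ω => by linarith [(abs_le.1 (hgm i ω)).2]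
  have hxm : ∀ i, Measurable ((S i).indicator fun ω => g i ω + m) := fun i =>
    ((hg i).add_const m).indicator (hS i)
  have hxb : ∀ i ω, |(S i).indicator (fun ω => g i ω + m) ω| ≤ 2 * m := fun i ω => by
    by_cases h : ω ∈ S i
    · rw [indicator_of_mem h, abs_of_nonneg (hg0 i ω)]
      exact hg2 i ω
    · rw [indicator_of_notMem h, abs_zero]
      exact (hg0 i ω).trans (hg2 i ω)
  let x : ι → Linf 𝔓 := fun i => ofBdd 𝔓 _ (hxm i) (2 * m) (hxb i)
  have hx : ∀ i, x i =ᵐ[polarMeasure 𝔓] (S i).indicator fun ω => g i ω + m := fun i =>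
    coeFn_ofBdd _ _
  obtain ⟨V, hV⟩ := hDC (range x) (range_nonempty _) ⟨constLinf 𝔓 (2 * m), by
    rintro _ ⟨i, rfl⟩
    rw [Linf.le_constLinf_iff]
    filter_upwards [hx i] with ω h1
    rw [h1]
    exact le_of_abs_le (hxb i ω)⟩
  have hxV : ∀ i, ∀ᵐ ω ∂polarMeasure 𝔓, (S i).indicator (fun ω => g i ω + m) ω ≤ V ω := fun i => by
    filter_upwards [Linf.le_iff.1 (hV.1 ⟨i, rfl⟩), hx i] with ω h1 h2
    rwa [h2] at h1
  obtain ⟨v, hvm, hvb, hv⟩ := exists_ofBdd_eq V le_rfl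
  have hvV : V =ᵐ[polarMeasure 𝔓] v := by
    have := coeFn_ofBdd (𝔓 := 𝔓) hvm hvb
    rwa [hv] at this
  refine ⟨V - constLinf 𝔓 m, fun i => ?_⟩
  have hWm : Measurable ((S i).piecewise (fun ω => g i ω + m) v) :=
    ((hg i).add_const m).piecewise (hS i) hvm
  have hWb : ∀ ω, |(S i).piecewise (fun ω => g i ω + m) v ω| ≤ max (2 * m) ‖V‖ := fun ω => by
    by_cases h : ω ∈ S i
    · rw [piecewise_eq_of_mem _ _ _ h, abs_of_nonneg (hg0 i ω)]
      exact (hg2 i ω).trans (le_max_left _ _)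
    · rw [piecewise_eq_of_notMem _ _ _ h]
      exact (hvb ω).trans (le_max_right _ _)
  -- Replacing `V` by `g i + m` on `S i` still gives an upper bound, by consistency; minimality of
  -- `V` gives the missing inequality on `S i`.
  have hVW : V ≤ ofBdd 𝔓 _ hWm _ hWb := hV.2 (by
    rintro _ ⟨j, rfl⟩
    rw [Linf.le_iff]
    filter_upwards [hx j, hxV j, coeFn_ofBdd (𝔓 := 𝔓) hWm hWb, hvV, hcons i j]
      with ω h1 h2 h3 h4 h5
    rw [h1, h3]
    by_cases hi : ω ∈ S i
    · rw [piecewise_eq_of_mem _ _ _ hi]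
      by_cases hj : ω ∈ S j
      · rw [indicator_of_mem hj, h5 ⟨hi, hj⟩]
      · rw [indicator_of_notMem hj]
        exact hg0 i ω
    · rw [piecewise_eq_of_notMem _ _ _ hi, ← h4]
      exact h2)
  filter_upwards [Linf.le_iff.1 hVW, hxV i, coeFn_ofBdd (𝔓 := 𝔓) hWm hWb,
    Lp.coeFn_sub V (constLinf 𝔓 m), coeFn_constLinf (𝔓 := 𝔓) m] with ω h1 h2 h3 h4 h5 hω
  rw [h3, piecewise_eq_of_mem _ _ _ hω] at h1
  rw [indicator_of_mem hω] at h2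
  rw [h4, Pi.sub_apply, h5]
  linarith

/-- A finite measure `μ ≪ 𝔓` is dominated by some `Q`, hence carried by `S Q`, where the glued `X`
equals the density of `φ` for `Q`. Signed measures follow by the Jordan decomposition. -/
theorem pairing_surjective (h𝔓 : 𝔓.Nonempty) (hDC : IsDedekindComplete (Linf 𝔓))
    (hoc : ∀ Q : ProbabilityMeasure Ω, (Q : Measure Ω) ≪ polarMeasure 𝔓 →
      OrderContinuous 𝔓 (Q : Measure Ω)) : Function.Surjective (pairing 𝔓) := by
  intro φ
  choose S hSm hSQ hSpolar using fun Q : AcIndex 𝔓 => exists_support hDC Q.2 (hoc Q.1 Q.2)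
  choose g hgm hgb hgφ using fun Q : AcIndex 𝔓 => exists_density_of_functional Q.2 φ
  have : Nonempty (AcIndex 𝔓) := by
    obtain ⟨P, hP⟩ := h𝔓
    exact ⟨⟨P, absolutelyContinuous_polarMeasure hP⟩⟩
  obtain ⟨X, hX⟩ := exists_glue hDC hSm hgm hgb fun Q R =>
    ae_eq_on_inter_support (hSm Q) (hSm R) (hSpolar Q) (hSpolar R) Q.2 R.2 (hgm Q) (hgm R) (hgb Q)
      (hgb R) (hgφ Q) (hgφ R)
  have hpos : ∀ (μ : Measure Ω) [IsFiniteMeasure μ] (hμ : μ ≪ polarMeasure 𝔓),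
      pairing 𝔓 X (toCa μ hμ) = φ (toCa μ hμ) := by
    intro μ _ hμ
    obtain ⟨Q, hQ⟩ := exists_acIndex_ac h𝔓 hμ
    rw [pairing_toCa, hgφ Q μ hQ]
    have hS : ∀ᵐ ω ∂μ, ω ∈ S Q := mem_ae_iff.2 (hQ (hSQ Q))
    refine integral_congr_ae ?_
    filter_upwards [hS, hμ.ae_le (hX Q)] with ω h1 h2
    exact h2 h1
  refine ⟨X, ?_⟩
  ext μ
  rw [ca_eq_sub μ, map_sub, map_sub, hpos, hpos]

theorem dualOfCaIsLinf_of_orderContinuous (h𝔓 : 𝔓.Nonempty) (hDC : IsDedekindComplete (Linf 𝔓))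
    (hoc : ∀ Q : ProbabilityMeasure Ω, (Q : Measure Ω) ≪ polarMeasure 𝔓 →
      OrderContinuous 𝔓 (Q : Measure Ω)) : DualOfCaIsLinf 𝔓 :=
  ⟨LinearIsometryEquiv.ofSurjective ⟨pairing 𝔓, norm_pairing⟩ (pairing_surjective h𝔓 hDC hoc),
    fun _ _ => rfl⟩

end

end QuasiSure

/-! ### The equivalence -/

theorem corollary5p11 {Ω : Type u} [MeasurableSpace Ω]
    (𝔓 : Set (ProbabilityMeasure Ω)) (h𝔓 : 𝔓.Nonempty)
    (hDC : QuasiSure.IsDedekindComplete (QuasiSure.Linf 𝔓)) :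
    (∀ ρ : QuasiSure.Linf 𝔓 → ℝ, QuasiSure.IsConvexRiskMeasure 𝔓 ρ →
      (QuasiSure.HasRobustRepresentation 𝔓 ρ ↔ QuasiSure.HasFatouProperty 𝔓 ρ)) ↔
    QuasiSure.DualOfCaIsLinf 𝔓 := by
  constructor
  · intro h
    exact QuasiSure.dualOfCaIsLinf_of_orderContinuous h𝔓 hDC fun Q hQ =>
      QuasiSure.orderContinuous_of_hasFatouProperty Q hQ
        ((h _ (QuasiSure.isConvexRiskMeasure_integral Q hQ)).1
          (QuasiSure.hasRobustRepresentation_integral Q hQ))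
  · intro h ρ hρ
    exact ⟨QuasiSure.hasFatouProperty_of_hasRobustRepresentation fun Q hQ =>
        QuasiSure.orderContinuous_of_dual h _ hQ,
      QuasiSure.hasRobustRepresentation_of_hasFatouProperty h𝔓 hDC h hρ⟩
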